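/- **Theorem.** Let $C$ be a group and $(B,\xi)$ a $C$-module (groups are written additively). *Abelian extensions.* Let $\mathcal H^2(C,B,\xi)$ be the category whose objects are the short exact sequences of groups $B\xrightarrow{\kappa}E\xrightarrow{\gamma}C$ whose conjugation action on $B$ is $\xi$, i.e. $\kappa(\xi(\gamma(e))(b))=e+\kappa(b)-e$, and whose arrows are the homomorphisms $E\to E'$ compatible with the maps from $B$ and to $C$. Its tensor product is the Baer sum, before passing to isomorphism classes: $E\oplus E'$ is the pushforward of $\kappa\times_C\kappa'\colon B\times B\to E\times_CE'$ along the codiagonal $[1,1]\colon B\times B\to B$, realized as the quotient of $E\times_CE'$ by the image of the kernel of the codiagonal, i.e. by $\{(\kappa b,-\kappa'b)\mid b\in B\}$. Its unit is the semidirect product extension $E_\rtimes\colon B\to B\rtimes_\xi C\to C$, and its symmetry is induced by $(x,y)\mapsto(y,x)$. *Butterflies.* A crossed extension of $C$ is an exact sequence $0\to B'\xrightarrow{j}E_2\xrightarrow{\partial}E_1\xrightarrow{p}C\to 0$ in which $\partial$ carries a crossed module structure. A butterfly $\widehat F\colon E\to E'$ between crossed extensions consists of a group $F$ and homomorphisms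 $\kappa\colon E_2\to F$, $\delta\colon F\to E_1$, $\iota\colon E_2'\to F$, $\gamma\colon F\to E_1'$ with $\delta\kappa=\partial$, $\gamma\iota=\partial'$, $p\delta=p'\gamma$, $\gamma\kappa=0$, with $E_2'\xrightarrow{\iota}F\xrightarrow{\delta}E_1$ short exact, and with $\kappa(\delta(f)\ast x)=f+\kappa(x)-f$ and $\iota(\gamma(f)\ast x')=f+\iota(x')-f$. Isomorphisms of butterflies are the isomorphisms of the groups $F$ compatible with $\kappa,\iota,\gamma,\delta$. The composite $\widehat F'\cdot\widehat F$ of $\widehat F\colon E\to E'$ and $\widehat F'\colon E'\to E''$ has as its group the quotient of $F\times_{E_1'}F'$ (the pullback of $\gamma$ and $\delta'$) by the image of $\langle\iota,\kappa'\rangle\colon E_2'\to F\times_{E_1'}F'$, with the maps induced by $\langle\kappa,0\rangle$, $\langle 0,\iota'\rangle$, $\delta$ and $\gamma'$. The identity butterfly of $E$ has group $E_2\rtimes E_1$, with $\delta=c$, $c(x,g)=g$, $\gamma=d$, $d(x,g)=\partial x+g$, $\iota(x)=(x,0)$ and $\kappa(x)=(-x,\partial x)$. *Self-equivalences.* Let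 $I_\xi$ be the crossed extension $0\to B=B\xrightarrow{0}C=C\to0$ with action $\xi$. Let $\mathsf{Eq}(I_\xi)$ be the category whose objects are the butterflies $I_\xi\to I_\xi$ with $\gamma=\delta$ and $\kappa=-\iota$ (equivalently, the flippable butterflies, i.e. those with $(\kappa,\gamma)$ also short exact, inducing the identity of $B$), and whose arrows are the isomorphisms of butterflies. Its tensor product is butterfly composition, $\widehat F\otimes\widehat F'=\widehat F'\cdot\widehat F$, its unit is the identity butterfly, and its symmetry is induced by $(x,y)\mapsto(y,x)$. Let $\Phi$ send the extension $(\kappa,\gamma)$ to the butterfly with group $E$ and maps $-\kappa,\kappa\colon B\to E$ (from the first, respectively second, copy of $I_\xi$) and $\gamma,\gamma\colon E\to C$, and send a morphism of extensions to the same homomorphism. Then $\mathcal H^2(C,B,\xi)$ and $\mathsf{Eq}(I_\xi)$, with their canonical associators and unitors, are symmetric 2-groups (symmetric monoidal groupoids in which every object is invertible up to isomorphism), and $$\Phi\colon\mathcal H^2(C,B,\xi)\to\mathsf{Eq}(I_\xi)$$ is a symmetric strict monoidal equivalence: it is an equivalence of categories; $\Phi(E\oplus E')=\Phi(E')\cdot\Phi(E)$,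 and $\Phi(E_\rtimes)$ is the identity butterfly of $I_\xi$; and, with these identities as coherence isomorphisms, $\Phi$ is a symmetric monoidal functor. -/

import Mathlib

open CategoryTheory MonoidalCategory

universe u

noncomputable section

/-! All groups are written multiplicatively; in particular a `C`-module `(B, ξ)` is a commutative
group `B` together with a homomorphism `ξ : C →* MulAut B`. -/

/-- A crossed extension `1 → B → E₂ → E₁ → C → 1` of the group `C`: an exact sequence in which
`∂ : E₂ → E₁` is a crossed module. (The kernel `B` is automatically central, hence commutative.) -/
structure CrossedExt (C : Type u) [Group C] where
  /-- the kernel of the crossed module -/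
  B : Type u
  [groupB : CommGroup B]
  /-- the top group -/
  E₂ : Type u
  [groupE₂ : Group E₂]
  /-- the bottom group -/
  E₁ : Type u
  [groupE₁ : Group E₁]
  /-- the inclusion of the kernel -/
  j : B →* E₂
  /-- the crossed module map -/
  bd : E₂ →* E₁
  /-- the projection on the cokernel -/
  p : E₁ →* C
  /-- the action of `E₁` on `E₂` -/
  act : E₁ →* MulAut E₂
  precrossed : ∀ g x, bd (act g x) = g * bd x * g⁻¹
  peiffer : ∀ x y, act (bd x) y = x * y * x⁻¹
  j_injective : Function.Injective j
  exact₂ : j.range = bd.ker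
  exact₁ : bd.range = p.ker
  p_surjective : Function.Surjective p

attribute [instance] CrossedExt.groupB CrossedExt.groupE₂ CrossedExt.groupE₁

/-- A butterfly `E → E'` between crossed extensions of `C`. -/
structure Butterfly {C : Type u} [Group C] (E E' : CrossedExt C) where
  /-- the central group of the butterfly -/
  F : Type u
  [group : Group F]
  /-- the wing `E₂ → F` -/
  κ : E.E₂ →* F
  /-- the wing `F → E₁'` -/
  γ : F →* E'.E₁
  /-- the wing `F → E₁` -/
  δ : F →* E.E₁
  /-- the wing `E₂' → F` -/
  ι : E'.E₂ →* F
  δ_κ : ∀ x, δ (κ x) = E.bd x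
  γ_ι : ∀ x, γ (ι x) = E'.bd x
  p_δ : ∀ f, E.p (δ f) = E'.p (γ f)
  γ_κ : ∀ x, γ (κ x) = 1
  ι_injective : Function.Injective ι
  exact : ι.range = δ.ker
  δ_surjective : Function.Surjective δ
  κ_act : ∀ f x, κ (E.act (δ f) x) = f * κ x * f⁻¹
  ι_act : ∀ f x, ι (E'.act (γ f) x) = f * ι x * f⁻¹

attribute [instance] Butterfly.group

namespace Butterfly

variable {C : Type u} [Group C] {E E' E'' E''' : CrossedExt C}

theorem δ_ι (F : Butterfly E E') (x : E'.E₂) : F.δ (F.ι x) = 1 := by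
  have : F.ι x ∈ F.δ.ker := F.exact ▸ ⟨x, rfl⟩
  exact this

theorem exists_ι (F : Butterfly E E') {x : F.F} (h : F.δ x = 1) : ∃ a, F.ι a = x := by
  have : x ∈ F.ι.range := F.exact ▸ h
  exact this

/-! ### Isomorphisms of butterflies -/

/-- An isomorphism of butterflies. -/
structure Hom (F G : Butterfly E E') where
  /-- the isomorphism of the central groups -/
  σ : F.F ≃* G.F
  σ_ι : ∀ x, σ (F.ι x) = G.ι x
  σ_κ : ∀ x, σ (F.κ x) = G.κ x
  γ_σ : ∀ f, G.γ (σ f) = F.γ f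
  δ_σ : ∀ f, G.δ (σ f) = F.δ f

theorem Hom.ext' {F G : Butterfly E E'} {s t : Hom F G} (h : ∀ x, s.σ x = t.σ x) : s = t := by
  cases s; cases t
  congr 1
  exact MulEquiv.ext h

/-- Butterflies `E → E'` and their isomorphisms form a category. -/
instance homCategory : Category.{u} (Butterfly E E') where
  Hom := Hom
  id F := ⟨MulEquiv.refl _, fun _ => rfl, fun _ => rfl, fun _ => rfl, fun _ => rfl⟩
  comp s t := ⟨s.σ.trans t.σ, fun x => by simp [s.σ_ι, t.σ_ι], fun x => by simp [s.σ_κ, t.σ_κ],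
    fun x => by simp [s.γ_σ, t.γ_σ], fun x => by simp [s.δ_σ, t.δ_σ]⟩
  id_comp _ := rfl
  comp_id _ := rfl
  assoc _ _ _ := rfl

@[simp] theorem id_σ (F : Butterfly E E') (x : F.F) : Hom.σ (𝟙 F) x = x := rfl

@[simp] theorem comp_σ {F G H : Butterfly E E'} (s : F ⟶ G) (t : G ⟶ H) (x : F.F) :
    Hom.σ (s ≫ t) x = Hom.σ t (Hom.σ s x) := rfl

/-- Every arrow between butterflies is invertible. -/
def toIso {F G : Butterfly E E'} (s : Hom F G) : F ≅ G where
  hom := s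
  inv := ⟨s.σ.symm, fun x => by simp [← s.σ_ι], fun x => by simp [← s.σ_κ],
    fun x => by simp [← s.γ_σ], fun x => by simp [← s.δ_σ]⟩
  hom_inv_id := Hom.ext' fun x => s.σ.symm_apply_apply x
  inv_hom_id := Hom.ext' fun x => s.σ.apply_symm_apply x

/-- By the short five lemma, a homomorphism of the central groups which is compatible with the
four wings is an isomorphism. -/
def homOfHom {F G : Butterfly E E'} (f : F.F →* G.F) (hι : ∀ x, f (F.ι x) = G.ι x)
    (hκ : ∀ x, f (F.κ x) = G.κ x) (hγ : ∀ x, G.γ (f x) = F.γ x) (hδ : ∀ x, G.δ (f x) = F.δ x) :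
    Hom F G where
  σ := MulEquiv.ofBijective f <| by
    constructor
    · rw [injective_iff_map_eq_one]
      intro x hx
      obtain ⟨a, rfl⟩ := F.exists_ι (x := x) (by rw [← hδ, hx, map_one])
      rw [hι] at hx
      rw [(injective_iff_map_eq_one _).1 G.ι_injective a hx, map_one]
    · intro y
      obtain ⟨x, hx⟩ := F.δ_surjective (G.δ y)
      obtain ⟨a, ha⟩ := G.exists_ι (x := y * (f x)⁻¹) (by simp [hδ, hx])
      exact ⟨F.ι a * x, by simp [hι, ha]⟩
  σ_ι := hι
  σ_κ := hκ
  γ_σ := hγ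
  δ_σ := hδ

@[simp] theorem homOfHom_σ {F G : Butterfly E E'} (f : F.F →* G.F) (hι hκ hγ hδ) (x : F.F) :
    (homOfHom (F := F) (G := G) f hι hκ hγ hδ).σ x = f x := rfl

/-- An isomorphism of butterflies presented by a group `T` covering both central groups. -/
def homOfCover {F G : Butterfly E E'} {T : Type u} [Group T] (s : T →* F.F) (t : T →* G.F)
    (hs : Function.Surjective s) (hker : s.ker ≤ t.ker)
    (hι : ∀ x, ∃ y, s y = F.ι x ∧ t y = G.ι x) (hκ : ∀ x, ∃ y, s y = F.κ x ∧ t y = G.κ x)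
    (hγ : ∀ y, G.γ (t y) = F.γ (s y)) (hδ : ∀ y, G.δ (t y) = F.δ (s y)) : Hom F G :=
  have key : ∀ y, s.liftOfSurjective hs ⟨t, hker⟩ (s y) = t y :=
    fun y => MonoidHom.liftOfRightInverse_comp_apply _ _ (Function.rightInverse_surjInv hs) _ y
  homOfHom (s.liftOfSurjective hs ⟨t, hker⟩)
    (fun x => by obtain ⟨y, h, h'⟩ := hι x; rw [← h, ← h', key])
    (fun x => by obtain ⟨y, h, h'⟩ := hκ x; rw [← h, ← h', key])
    (fun x => by obtain ⟨y, rfl⟩ := hs x; rw [key, hγ])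
    (fun x => by obtain ⟨y, rfl⟩ := hs x; rw [key, hδ])

theorem homOfCover_σ {F G : Butterfly E E'} {T : Type u} [Group T] (s : T →* F.F) (t : T →* G.F)
    (hs hker hι hκ hγ hδ) (y : T) :
    (homOfCover (F := F) (G := G) s t hs hker hι hκ hγ hδ).σ (s y) = t y :=
  MonoidHom.liftOfRightInverse_comp_apply _ _ (Function.rightInverse_surjInv hs) _ y

/-! ### The identity butterfly -/

/-- The identity butterfly, with central group `E₂ ⋊ E₁`, where `c (x, g) = g` and
`d (x, g) = ∂ x * g`; the wings out of `E₂` are the kernels of `d` and of `c`. -/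
def idButterfly (E : CrossedExt C) : Butterfly E E where
  F := E.E₂ ⋊[E.act] E.E₁
  κ := MonoidHom.mk' (fun x => ⟨x⁻¹, E.bd x⟩) fun a b => by
    apply SemidirectProduct.ext <;> simp [E.peiffer, mul_assoc]
  γ := MonoidHom.mk' (fun y => E.bd y.left * y.right) fun a b => by
    simp [E.precrossed, mul_assoc]
  δ := SemidirectProduct.rightHom
  ι := SemidirectProduct.inl
  δ_κ _ := rfl
  γ_ι x := by simp
  p_δ f := by
    have h : E.p (E.bd f.left) = 1 := by
      have : E.bd f.left ∈ E.p.ker := E.exact₁ ▸ ⟨_, rfl⟩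
      exact this
    simp [h]
  γ_κ x := by simp
  ι_injective := SemidirectProduct.inl_injective
  exact := SemidirectProduct.range_inl_eq_ker_rightHom
  δ_surjective := SemidirectProduct.rightHom_surjective
  κ_act f x := by
    apply SemidirectProduct.ext
    · simp [E.peiffer, mul_assoc]
    · simp [E.precrossed]
  ι_act f x := by
    apply SemidirectProduct.ext
    · simp [E.peiffer, mul_assoc]
    · simp

/-! ### Composition of butterflies -/

/-- The pullback `F ×_{E₁'} F'` of `γ` and `δ'`. -/
def fib (F : Butterfly E E') (G : Butterfly E' E'') : Subgroup (F.F × G.F) :=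
  (F.γ.comp (MonoidHom.fst F.F G.F)).eqLocus (G.δ.comp (MonoidHom.snd F.F G.F))

/-- The homomorphism `⟨ι, κ'⟩ : E₂' → F ×_{E₁'} F'`. -/
def skew (F : Butterfly E E') (G : Butterfly E' E'') : E'.E₂ →* F.fib G :=
  (F.ι.prod G.κ).codRestrict (F.fib G) fun x => (F.γ_ι x).trans (G.δ_κ x).symm

instance skew_normal (F : Butterfly E E') (G : Butterfly E' E'') : (F.skew G).range.Normal where
  conj_mem := by
    rintro _ ⟨a, rfl⟩ ⟨⟨x, y⟩, h⟩
    refine ⟨E'.act (F.γ x) a, Subtype.ext (Prod.ext (F.ι_act x a) ?_)⟩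
    have h' : F.γ x = G.δ y := h
    exact (congrArg (fun z => G.κ (E'.act z a)) h').trans (G.κ_act y a)

/-- The central group of the composite butterfly: the cokernel of `⟨ι, κ'⟩`. -/
abbrev CompGroup (F : Butterfly E E') (G : Butterfly E' E'') : Type u :=
  F.fib G ⧸ (F.skew G).range

/-- The class of `(x, y)` in the central group of the composite. -/
def cls (F : Butterfly E E') (G : Butterfly E' E'') (x : F.F) (y : G.F) (h : F.γ x = G.δ y) :
    F.CompGroup G :=
  QuotientGroup.mk ⟨(x, y), h⟩

theorem exists_cls (F : Butterfly E E') (G : Butterfly E' E'') (z : F.CompGroup G) :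
    ∃ x y h, z = F.cls G x y h := by
  induction z using QuotientGroup.induction_on with
  | H z => exact ⟨z.1.1, z.1.2, z.2, rfl⟩

theorem cls_mul (F : Butterfly E E') (G : Butterfly E' E'') {x y h x' y' h'} :
    F.cls G x y h * F.cls G x' y' h' = F.cls G (x * x') (y * y') (by simp [h, h']) := rfl

theorem cls_eq_cls (F : Butterfly E E') (G : Butterfly E' E'') {x y h x' y' h'} :
    F.cls G x y h = F.cls G x' y' h' ↔ ∃ a, x * F.ι a = x' ∧ y * G.κ a = y' := by
  unfold cls
  rw [QuotientGroup.eq]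
  constructor
  · rintro ⟨a, ha⟩
    have h1 : F.ι a = x⁻¹ * x' := congrArg (fun z => z.1.1) ha
    have h2 : G.κ a = y⁻¹ * y' := congrArg (fun z => z.1.2) ha
    exact ⟨a, by simp [h1], by simp [h2]⟩
  · rintro ⟨a, rfl, rfl⟩
    exact ⟨a, Subtype.ext (Prod.ext (inv_mul_cancel_left x (F.ι a)).symm
      (inv_mul_cancel_left y (G.κ a)).symm)⟩

theorem cls_eq_one (F : Butterfly E E') (G : Butterfly E' E'') {x y h} :
    F.cls G x y h = 1 ↔ ∃ a, F.ι a = x ∧ G.κ a = y := by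
  have : (1 : F.CompGroup G) = F.cls G 1 1 (by simp) := rfl
  rw [this, eq_comm, cls_eq_cls]
  simp

/-- The composite `F' · F` of the butterflies `F : E → E'` and `F' : E' → E''`. -/
def comp (F : Butterfly E E') (G : Butterfly E' E'') : Butterfly E E'' where
  F := F.CompGroup G
  κ := MonoidHom.mk' (fun x => F.cls G (F.κ x) 1 (by simp [F.γ_κ])) fun a b => by
    simp [cls_mul]
  γ := QuotientGroup.lift _ (G.γ.comp ((MonoidHom.snd F.F G.F).comp (F.fib G).subtype)) <| by
    rintro _ ⟨a, rfl⟩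
    exact G.γ_κ a
  δ := QuotientGroup.lift _ (F.δ.comp ((MonoidHom.fst F.F G.F).comp (F.fib G).subtype)) <| by
    rintro _ ⟨a, rfl⟩
    exact F.δ_ι a
  ι := MonoidHom.mk' (fun x => F.cls G 1 (G.ι x) (by simp [G.δ_ι])) fun a b => by
    simp [cls_mul]
  δ_κ x := F.δ_κ x
  γ_ι x := G.γ_ι x
  p_δ z := by
    obtain ⟨x, y, h, rfl⟩ := F.exists_cls G z
    exact (F.p_δ x).trans ((congrArg E'.p h).trans (G.p_δ y))
  γ_κ _ := map_one G.γ
  ι_injective := by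
    rw [injective_iff_map_eq_one]
    intro b hb
    obtain ⟨a, h1, h2⟩ := (F.cls_eq_one G).1 hb
    obtain rfl : a = 1 := F.ι_injective (by rw [h1, map_one])
    exact G.ι_injective (by rw [← h2, map_one, map_one])
  exact := by
    ext z
    constructor
    · rintro ⟨b, rfl⟩
      exact map_one F.δ
    · intro hz
      obtain ⟨x, y, h, rfl⟩ := F.exists_cls G z
      obtain ⟨a, rfl⟩ := F.exists_ι (x := x) hz
      obtain ⟨b, hb⟩ := G.exists_ι (x := y * (G.κ a)⁻¹) (by simp [← h, F.γ_ι, G.δ_κ])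
      refine ⟨b, (F.cls_eq_cls G).2 ⟨a, by simp, by simp [hb]⟩⟩
  δ_surjective e := by
    obtain ⟨x, hx⟩ := F.δ_surjective e
    obtain ⟨y, hy⟩ := G.δ_surjective (F.γ x)
    exact ⟨F.cls G x y hy.symm, hx⟩
  κ_act z a := by
    obtain ⟨x, y, h, rfl⟩ := F.exists_cls G z
    rw [eq_mul_inv_iff_mul_eq]
    refine (F.cls_eq_cls G).2 ⟨1, ?_, ?_⟩
    · have := F.κ_act x a
      rw [eq_mul_inv_iff_mul_eq] at this
      exact (congrArg (_ * ·) (map_one F.ι)).trans ((mul_one _).trans this)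
    · simp
  ι_act z a := by
    obtain ⟨x, y, h, rfl⟩ := F.exists_cls G z
    rw [eq_mul_inv_iff_mul_eq]
    refine (F.cls_eq_cls G).2 ⟨1, ?_, ?_⟩
    · simp
    · have := G.ι_act y a
      rw [eq_mul_inv_iff_mul_eq] at this
      exact (congrArg (_ * ·) (map_one G.κ)).trans ((mul_one _).trans this)

@[simp] theorem comp_γ (F : Butterfly E E') (G : Butterfly E' E'') {x y h} :
    (F.comp G).γ (F.cls G x y h) = G.γ y := rfl

@[simp] theorem comp_δ (F : Butterfly E E') (G : Butterfly E' E'') {x y h} :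
    (F.comp G).δ (F.cls G x y h) = F.δ x := rfl

theorem comp_ι (F : Butterfly E E') (G : Butterfly E' E'') (x : E''.E₂) :
    (F.comp G).ι x = F.cls G 1 (G.ι x) (by simp [G.δ_ι]) := rfl

theorem comp_κ (F : Butterfly E E') (G : Butterfly E' E'') (x : E.E₂) :
    (F.comp G).κ x = F.cls G (F.κ x) 1 (by simp [F.γ_κ]) := rfl

/-- Homomorphisms out of the central group of a composite. -/
def descHom (F : Butterfly E E') (G : Butterfly E' E'') {H : Type u} [Group H]
    (f : ∀ x y, F.γ x = G.δ y → H)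
    (hf : ∀ x y h x' y' h' h'', f (x * x') (y * y') h'' = f x y h * f x' y' h')
    (h1 : ∀ a h, f (F.ι a) (G.κ a) h = 1) : F.CompGroup G →* H :=
  QuotientGroup.lift _ (MonoidHom.mk' (fun z : F.fib G => f z.1.1 z.1.2 z.2)
    fun z w => hf _ _ _ _ _ _ _) <| by
      rintro _ ⟨a, rfl⟩
      exact h1 a _

/-- Composition is functorial in both variables: `(x, y) ↦ (s x, t y)`. -/
def compMap {F F' : Butterfly E E'} {G G' : Butterfly E' E''} (s : Hom F F') (t : Hom G G') :
    Hom (F.comp G) (F'.comp G') :=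
  homOfHom (F := F.comp G) (G := F'.comp G')
    (descHom F G (fun x y h => F'.cls G' (s.σ x) (t.σ y) (by rw [s.γ_σ, t.δ_σ, h]))
      (by intros; simp only [map_mul]; rfl) fun a _ => (cls_eq_one _ _).2 ⟨a, (s.σ_ι a).symm, (t.σ_κ a).symm⟩)
    (fun x => (cls_eq_cls _ _).2 ⟨1, by simp, by simp [t.σ_ι]⟩)
    (fun x => (cls_eq_cls _ _).2 ⟨1, by simp [s.σ_κ], by simp⟩)
    (fun z => by obtain ⟨x, y, h, rfl⟩ := exists_cls _ _ z; exact t.γ_σ y)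
    (fun z => by obtain ⟨x, y, h, rfl⟩ := exists_cls _ _ z; exact s.δ_σ x)

theorem compMap_cls {F F' : Butterfly E E'} {G G' : Butterfly E' E''} (s : Hom F F')
    (t : Hom G G') {x y h} : (compMap s t).σ (F.cls G x y h) =
      F'.cls G' (s.σ x) (t.σ y) (by rw [s.γ_σ, t.δ_σ, h]) := rfl

/-- The left unitor `((a, g), f) ↦ κ(a)⁻¹ f`. -/
def leftUnit (F : Butterfly E E') : Hom ((idButterfly E).comp F) F :=
  homOfHom (F := (idButterfly E).comp F) (G := F)
    (descHom (idButterfly E) F (fun x y _ => (F.κ x.left)⁻¹ * y)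
      (by
        intro x y h x' y' h' _
        have h2 : E.bd x.left * x.right = F.δ y := h
        have key : y * F.κ x'.left * y⁻¹ =
            F.κ x.left * F.κ (E.act x.right x'.left) * (F.κ x.left)⁻¹ := by
          rw [← F.κ_act, ← h2, map_mul, MulAut.mul_apply, E.peiffer]; simp
        rw [mul_inv_eq_iff_eq_mul] at key
        have key2 : (F.κ x.left)⁻¹ * y * (F.κ x'.left)⁻¹ =
            (F.κ (E.act x.right x'.left))⁻¹ * (F.κ x.left)⁻¹ * y := by
          rw [mul_inv_eq_iff_eq_mul, mul_assoc _ y, key]; group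
        change (F.κ (x.left * E.act x.right x'.left))⁻¹ * (y * y') = _
        rw [← mul_assoc, ← mul_assoc ((F.κ x.left)⁻¹ * y), key2]
        simp [mul_assoc])
      (fun a _ => inv_mul_cancel (F.κ a)))
    (fun x => by change (F.κ 1)⁻¹ * F.ι x = F.ι x; simp)
    (fun x => by change (F.κ x⁻¹)⁻¹ * 1 = F.κ x; simp)
    (fun z => by
      obtain ⟨x, y, h, rfl⟩ := exists_cls _ _ z
      change F.γ ((F.κ x.left)⁻¹ * y) = F.γ y
      simp [F.γ_κ])
    (fun z => by
      obtain ⟨x, y, h, rfl⟩ := exists_cls _ _ z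
      change F.δ ((F.κ x.left)⁻¹ * y) = x.right
      have h2 : E.bd x.left * x.right = F.δ y := h
      simp [F.δ_κ, ← h2])

theorem leftUnit_cls (F : Butterfly E E') {x : E.E₂ ⋊[E.act] E.E₁} {y h} :
    (leftUnit F).σ ((idButterfly E).cls F x y h) = (F.κ x.left)⁻¹ * y := rfl

/-- The right unitor `(f, (a, g)) ↦ ι(a) f`. -/
def rightUnit (F : Butterfly E E') : Hom (F.comp (idButterfly E')) F :=
  homOfHom (F := F.comp (idButterfly E')) (G := F)
    (descHom F (idButterfly E') (fun x y _ => F.ι y.left * x)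
      (by
        intro x y h x' y' h' _
        have h2 : F.γ x = y.right := h
        have key := F.ι_act x y'.left
        rw [eq_mul_inv_iff_mul_eq, h2] at key
        change F.ι (y.left * E'.act y.right y'.left) * (x * x') = _
        rw [map_mul, mul_assoc, ← mul_assoc _ x, key]
        simp [mul_assoc])
      (fun a _ => by
        change F.ι a⁻¹ * F.ι a = 1
        simp))
    (fun x => by change F.ι x * 1 = F.ι x; simp)
    (fun x => by change F.ι 1 * F.κ x = F.κ x; simp)
    (fun z => by
      obtain ⟨x, y, h, rfl⟩ := exists_cls _ _ z
      change F.γ (F.ι y.left * x) = E'.bd y.left * y.right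
      have h2 : F.γ x = y.right := h
      simp [F.γ_ι, h2])
    (fun z => by
      obtain ⟨x, y, h, rfl⟩ := exists_cls _ _ z
      change F.δ (F.ι y.left * x) = F.δ x
      simp [F.δ_ι])

theorem rightUnit_cls (F : Butterfly E E') {x} {y : E'.E₂ ⋊[E'.act] E'.E₁} {h} :
    (rightUnit F).σ (F.cls (idButterfly E') x y h) = F.ι y.left * x := rfl

/-- The iterated pullback of composable butterflies. -/
def fib₃ (F : Butterfly E E') (G : Butterfly E' E'') (H : Butterfly E'' E''') :
    Subgroup (F.F × G.F × H.F) where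
  carrier := {t | F.γ t.1 = G.δ t.2.1 ∧ G.γ t.2.1 = H.δ t.2.2}
  mul_mem' := by rintro a b ⟨h, h'⟩ ⟨k, k'⟩; simp [h, h', k, k']
  one_mem' := by simp
  inv_mem' := by rintro a ⟨h, h'⟩; simp [h, h']

/-- The associator `((x, y), z) ↦ (x, (y, z))`. -/
def assoc (F : Butterfly E E') (G : Butterfly E' E'') (H : Butterfly E'' E''') :
    Hom ((F.comp G).comp H) (F.comp (G.comp H)) :=
  homOfCover (F := (F.comp G).comp H) (G := F.comp (G.comp H)) (T := fib₃ F G H)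
    (MonoidHom.mk' (fun t => (F.comp G).cls H (F.cls G t.1.1 t.1.2.1 t.2.1) t.1.2.2 t.2.2)
      fun _ _ => rfl)
    (MonoidHom.mk' (fun t => F.cls (G.comp H) t.1.1 (G.cls H t.1.2.1 t.1.2.2 t.2.2) t.2.1)
      fun _ _ => rfl)
    (fun w => by
      obtain ⟨w, z, h, rfl⟩ := exists_cls _ _ w
      obtain ⟨x, y, h', rfl⟩ := exists_cls _ _ w
      exact ⟨⟨(x, y, z), h', h⟩, rfl⟩)
    (by
      rintro ⟨⟨x, y, z⟩, h, h'⟩ hw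
      obtain ⟨a, h1, h2⟩ := (cls_eq_one _ _).1 (MonoidHom.mem_ker.1 hw)
      obtain ⟨b, h3, h4⟩ := (cls_eq_cls _ _).1 h1
      refine (cls_eq_one _ _).2 ⟨b, by simpa using h3, (cls_eq_cls _ _).2 ⟨a, ?_, by simpa using h2⟩⟩
      refine Eq.trans ?_ (show G.ι a * G.κ b = y from h4)
      have := G.ι_act (G.κ b) a
      rw [G.γ_κ, map_one, MulAut.one_apply, eq_mul_inv_iff_mul_eq] at this
      exact this.symm)
    (fun x => ⟨⟨(1, 1, H.ι x), by simp, by simp [H.δ_ι]⟩, rfl, rfl⟩)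
    (fun x => ⟨⟨(F.κ x, 1, 1), by simp [F.γ_κ], by simp⟩, rfl, rfl⟩)
    (fun _ => rfl) (fun _ => rfl)

theorem assoc_cls (F : Butterfly E E') (G : Butterfly E' E'') (H : Butterfly E'' E''') {x y h z}
    (h' : G.γ y = H.δ z) : (assoc F G H).σ ((F.comp G).cls H (F.cls G x y h) z h') =
      F.cls (G.comp H) x (G.cls H y z h') h :=
  homOfCover_σ (F := (F.comp G).comp H) (G := F.comp (G.comp H)) (T := fib₃ F G H)
    _ _ _ _ _ _ _ _ ⟨(x, y, z), h, h'⟩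

theorem assoc_inv_cls (F : Butterfly E E') (G : Butterfly E' E'') (H : Butterfly E'' E''')
    {x y z} (h : F.γ x = G.δ y) (h' : G.γ y = H.δ z) :
    (assoc F G H).σ.symm (F.cls (G.comp H) x (G.cls H y z h') h) =
      (F.comp G).cls H (F.cls G x y h) z h' :=
  (MulEquiv.symm_apply_eq _).2 (assoc_cls F G H h').symm

end Butterfly


/-! ### The bicategory of crossed extensions and butterflies -/

section Bicat

open Butterfly

variable {C : Type u} [Group C]

theorem eq_conj {E E' : CrossedExt C} {F F' G G' : Butterfly E E'} {s : F ⟶ F'} {t : G ⟶ G'}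
    {u : Hom F G} {v : Hom F' G'} (h : ∀ x, v.σ (Hom.σ s x) = Hom.σ t (u.σ x)) :
    s = (toIso u).hom ≫ t ≫ (toIso v).inv := by
  rw [← Category.assoc, Iso.eq_comp_inv]
  exact Hom.ext' h

theorem eq_conj_inv {E E' : CrossedExt C} {F F' G G' : Butterfly E E'} {s : G ⟶ G'}
    {t : F ⟶ F'} {u : Hom F G} {v : Hom F' G'} (h : ∀ x, Hom.σ s (u.σ x) = v.σ (Hom.σ t x)) :
    s = (toIso u).inv ≫ t ≫ (toIso v).hom := by
  rw [Iso.eq_inv_comp]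
  exact Hom.ext' h

theorem cls_congr {E E' E'' : CrossedExt C} (F : Butterfly E E') (G : Butterfly E' E'')
    {x x' y y' h h'} (hx : x = x') (hy : y = y') : F.cls G x y h = F.cls G x' y' h' := by
  subst hx hy
  rfl

theorem triangle_aux {E E' E'' : CrossedExt C} (F : Butterfly E E') (G : Butterfly E' E'')
    (x : F.F) (y : E'.E₂ ⋊[E'.act] E'.E₁) (z : G.F) (h : F.γ x = y.right)
    (h' : E'.bd y.left * y.right = G.δ z) :
    F.cls G x ((G.κ y.left)⁻¹ * z) (by simp [h, ← h', G.δ_κ]) =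
      F.cls G (F.ι y.left * x) z (by simp [h, ← h', F.γ_ι]) := by
  have e : E'.act y.right ((E'.act y.right)⁻¹ y.left) = y.left := MulAut.apply_inv_self _ _ _
  refine (cls_eq_cls F G).2 ⟨(E'.act y.right)⁻¹ y.left, ?_, ?_⟩
  · have key := F.ι_act x ((E'.act y.right)⁻¹ y.left)
    rw [h, e, eq_mul_inv_iff_mul_eq] at key
    exact key.symm
  · have key := G.κ_act z ((E'.act y.right)⁻¹ y.left)
    rw [← h', map_mul, MulAut.mul_apply, e, E'.peiffer, mul_inv_cancel_right,
      eq_mul_inv_iff_mul_eq] at key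
    rw [mul_assoc, ← key, inv_mul_cancel_left]

/-- Crossed extensions of `C`, butterflies and isomorphisms of butterflies form a bicategory;
`F ≫ F'` is the composite `F' · F`. -/
instance butterflyBicategory : Bicategory.{u, u + 1} (CrossedExt.{u} C) where
  Hom E E' := Butterfly E E'
  id E := idButterfly E
  comp F G := F.comp G
  homCategory _ _ := Butterfly.homCategory
  whiskerLeft F _ _ t := compMap (𝟙 F) t
  whiskerRight s H := compMap s (𝟙 H)
  associator F G H := toIso (assoc F G H)
  leftUnitor F := toIso (leftUnit F)
  rightUnitor F := toIso (rightUnit F)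
  whiskerLeft_id F G := Hom.ext' fun z => by
    obtain ⟨x, y, h, rfl⟩ := exists_cls _ _ z
    rfl
  whiskerLeft_comp F _ _ _ s t := Hom.ext' fun z => by
    obtain ⟨x, y, h, rfl⟩ := exists_cls _ _ z
    rfl
  id_whiskerLeft {a b F G} s := eq_conj fun z => by
    obtain ⟨x, y, h, rfl⟩ := exists_cls _ _ z
    change (G.κ _)⁻¹ * s.σ y = s.σ ((F.κ _)⁻¹ * y)
    rw [map_mul, map_inv, s.σ_κ]
    rfl
  comp_whiskerLeft F G H H' s := eq_conj fun w => by
    obtain ⟨w, z, h, rfl⟩ := exists_cls _ _ w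
    obtain ⟨x, y, h', rfl⟩ := exists_cls _ _ w
    exact (assoc_cls F G H' (x := x) (y := y) (z := s.σ z) (h := h')
      (by rw [s.δ_σ]; exact h)).trans
        (congrArg (compMap (𝟙 F) (compMap (𝟙 G) s)).σ (assoc_cls F G H (h := h') h)).symm
  id_whiskerRight F G := Hom.ext' fun z => by
    obtain ⟨x, y, h, rfl⟩ := exists_cls _ _ z
    rfl
  comp_whiskerRight s t _ := Hom.ext' fun z => by
    obtain ⟨x, y, h, rfl⟩ := exists_cls _ _ z
    rfl
  whiskerRight_id {a b F G} s := eq_conj fun z => by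
    obtain ⟨x, y, h, rfl⟩ := exists_cls _ _ z
    change G.ι _ * s.σ x = s.σ (F.ι _ * x)
    rw [map_mul, s.σ_ι]
    rfl
  whiskerRight_comp {a b c d F F'} s G H := eq_conj_inv fun w => by
    obtain ⟨w, z, h, rfl⟩ := exists_cls _ _ w
    obtain ⟨x, y, h', rfl⟩ := exists_cls _ _ w
    exact (congrArg (compMap s (𝟙 (G.comp H))).σ (assoc_cls F G H (h := h') h)).trans
      (assoc_cls F' G H (x := s.σ x) (y := y) (z := z) (h := by rw [s.γ_σ]; exact h') h).symm
  whisker_assoc F G G' s H := eq_conj fun w => by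
    obtain ⟨w, z, h, rfl⟩ := exists_cls _ _ w
    obtain ⟨x, y, h', rfl⟩ := exists_cls _ _ w
    exact (assoc_cls F G' H (x := x) (y := s.σ y) (z := z) (h := by rw [s.δ_σ]; exact h')
      (by rw [s.γ_σ]; exact h)).trans
        (congrArg (compMap (𝟙 F) (compMap s (𝟙 H))).σ (assoc_cls F G H (h := h') h)).symm
  whisker_exchange s t := Hom.ext' fun z => by
    obtain ⟨x, y, h, rfl⟩ := exists_cls _ _ z
    rfl
  pentagon F G H K := Hom.ext' fun v => by
    obtain ⟨v, t, h₁, rfl⟩ := exists_cls _ _ v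
    obtain ⟨w, z, h₂, rfl⟩ := exists_cls _ _ v
    obtain ⟨x, y, h₃, rfl⟩ := exists_cls _ _ w
    have h₁' : H.γ z = K.δ t := h₁
    have h₂' : G.γ y = H.δ z := h₂
    have e1 : (compMap (assoc F G H) (𝟙 K)).σ
        (((F.comp G).comp H).cls K ((F.comp G).cls H (F.cls G x y h₃) z h₂) t h₁) =
        (F.comp (G.comp H)).cls K (F.cls (G.comp H) x (G.cls H y z h₂') h₃) t h₁' :=
      cls_congr (F.comp (G.comp H)) K (assoc_cls F G H h₂') rfl
    have e2 := assoc_cls F (G.comp H) K (x := x) (y := G.cls H y z h₂') (z := t) (h := h₃) h₁'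
    have e3 : (compMap (𝟙 F) (assoc G H K)).σ
        (F.cls ((G.comp H).comp K) x ((G.comp H).cls K (G.cls H y z h₂') t h₁') h₃) =
        F.cls (G.comp (H.comp K)) x (G.cls (H.comp K) y (H.cls K z t h₁') h₂') h₃ :=
      cls_congr F (G.comp (H.comp K)) rfl (assoc_cls G H K h₁')
    have e4 := assoc_cls (F.comp G) H K (x := F.cls G x y h₃) (y := z) (z := t) (h := h₂) h₁'
    have e5 := assoc_cls F G (H.comp K) (x := x) (y := y) (z := H.cls K z t h₁') (h := h₃) h₂'
    exact ((congrArg _ ((congrArg _ e1).trans e2)).trans e3).trans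
      ((congrArg (assoc F G (H.comp K)).σ e4).trans e5).symm
  triangle F G := Hom.ext' fun w => by
    obtain ⟨w, z, h, rfl⟩ := exists_cls _ _ w
    obtain ⟨x, y, h', rfl⟩ := exists_cls _ _ w
    refine (congrArg (compMap (𝟙 F) (leftUnit G)).σ (assoc_cls F _ G (h := h') h)).trans ?_
    exact triangle_aux F G x y z h' h

end Bicat

/-! ### The unit crossed extension and its self-equivalences -/

section SelfEquivalences

variable {C B : Type u} [Group C] [CommGroup B]

/-- The unit crossed extension `I_ξ`, namely `1 → B = B → C = C → 1` with trivial middle map. -/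
abbrev unitCrossedExt (ξ : C →* MulAut B) : CrossedExt C where
  B := B
  E₂ := B
  E₁ := C
  j := MonoidHom.id B
  bd := 1
  p := MonoidHom.id C
  act := ξ
  precrossed _ _ := by simp
  peiffer x y := by simp
  j_injective := Function.injective_id
  exact₂ := by ext; simp
  exact₁ := by ext; simp
  p_surjective := Function.surjective_id

/-- The butterflies from `I_ξ` to itself whose two right wings are equal and whose left wings are
inverse to each other. In a butterfly from `I_ξ` to itself the condition `p · δ = p' · γ` says that
the right wings agree; the second condition says that the induced endomorphism of the
`C`-module `(B, ξ)` is the identity. -/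
def isSelfEquivalence (ξ : C →* MulAut B) : ObjectProperty (EndMonoidal (unitCrossedExt ξ)) :=
  fun F => Butterfly.γ F = Butterfly.δ F ∧
    ∀ b : B, Butterfly.κ F b = (Butterfly.ι F b)⁻¹

/-- A butterfly from `I_ξ` to itself is a self-equivalence in the sense above if and only if it is
flippable, i.e. `(κ, γ)` is a short exact sequence, and it induces the identity of `B`. -/
theorem isSelfEquivalence_iff (ξ : C →* MulAut B)
    (F : Butterfly (unitCrossedExt ξ) (unitCrossedExt ξ)) : isSelfEquivalence ξ F ↔
      (Function.Injective F.κ ∧ F.κ.range = F.γ.ker ∧ Function.Surjective F.γ) ∧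
        ∀ b : B, F.κ b * F.ι b = 1 := by
  constructor
  · rintro ⟨h, h'⟩
    refine ⟨⟨fun a b hab => ?_, ?_, h ▸ F.δ_surjective⟩, fun b => ?_⟩
    · have hab' : (F.ι a)⁻¹ = (F.ι b)⁻¹ := (h' a).symm.trans (hab.trans (h' b))
      exact F.ι_injective (inv_injective hab')
    · rw [h, ← F.exact]
      ext x
      constructor
      · rintro ⟨b, rfl⟩
        exact ⟨(b : B)⁻¹, (map_inv F.ι b).trans (h' b).symm⟩
      · rintro ⟨b, rfl⟩
        exact ⟨(b : B)⁻¹, (map_inv F.κ b).trans (inv_eq_iff_eq_inv.2 (h' b))⟩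
    · exact mul_eq_one_iff_eq_inv.2 (h' b)
  · rintro ⟨_, h⟩
    exact ⟨MonoidHom.ext fun x => (F.p_δ x).symm, fun b => mul_eq_one_iff_eq_inv.1 (h b)⟩

/-- The category `Eq(I_ξ)` of self-equivalences of the unit crossed extension and their
isomorphisms. -/
abbrev SelfEquiv (ξ : C →* MulAut B) := (isSelfEquivalence ξ).FullSubcategory

/-- Self-equivalences contain the identity butterfly and are closed under composition; so the
tensor product of `Eq(I_ξ)` is the composition of butterflies (`X ⊗ Y` is `Y · X`), with
associator and unitors those of the bicategory of butterflies. -/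
instance isSelfEquivalence_isMonoidal (ξ : C →* MulAut B) : (isSelfEquivalence ξ).IsMonoidal where
  prop_unit := by
    refine ⟨MonoidHom.ext fun x => one_mul _, fun b => ?_⟩
    apply SemidirectProduct.ext
    · change b⁻¹ = ξ (1⁻¹) b⁻¹
      simp
    · exact inv_one.symm
  prop_tensor F G hF hG := by
    refine ⟨MonoidHom.ext fun z => ?_, fun b => ?_⟩
    · obtain ⟨x, y, h, rfl⟩ := Butterfly.exists_cls F G z
      exact (congrFun (congrArg DFunLike.coe hG.1) y).trans
        (h.symm.trans (congrFun (congrArg DFunLike.coe hF.1) x))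
    · refine (Butterfly.cls_eq_cls F G).2 ⟨b, ?_, ?_⟩
      · change Butterfly.κ F b * Butterfly.ι F b = 1⁻¹
        rw [hF.2, inv_one, inv_mul_cancel]
      · exact (one_mul _).trans (hG.2 b)

/-- The swap `(x, y) ↦ (y, x)` between the two composites of two self-equivalences. -/
def swapHom (ξ : C →* MulAut B) (X Y : SelfEquiv ξ) :
    Butterfly.Hom (Butterfly.comp X.obj Y.obj) (Butterfly.comp Y.obj X.obj) :=
  have hX : ∀ x, Butterfly.γ X.obj x = Butterfly.δ X.obj x :=
    fun x => congrFun (congrArg DFunLike.coe X.property.1) x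
  have hY : ∀ x, Butterfly.γ Y.obj x = Butterfly.δ Y.obj x :=
    fun x => congrFun (congrArg DFunLike.coe Y.property.1) x
  Butterfly.homOfHom (F := Butterfly.comp X.obj Y.obj) (G := Butterfly.comp Y.obj X.obj)
    (Butterfly.descHom X.obj Y.obj
      (fun x y h => Butterfly.cls Y.obj X.obj y x ((hY y).trans (h.symm.trans (hX x))))
      (fun _ _ _ _ _ _ _ => rfl)
      (fun a _ => (Butterfly.cls_eq_one _ _).2 ⟨(a : B)⁻¹, by
        rw [X.property.2, Y.property.2, map_inv, map_inv, inv_inv]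
        exact ⟨rfl, rfl⟩⟩))
    (fun b => (Butterfly.cls_eq_cls _ _).2 ⟨(b : B)⁻¹, by
        rw [X.property.2, map_inv, map_inv, inv_inv]
        exact ⟨mul_inv_cancel _, one_mul _⟩⟩)
    (fun b => (Butterfly.cls_eq_cls _ _).2 ⟨(b : B)⁻¹,
        (one_mul _).trans ((map_inv _ _).trans (Y.property.2 b).symm),
        (congrArg (_ * ·) (map_inv (Butterfly.κ X.obj) b)).trans (mul_inv_cancel _)⟩)
    (fun z => by
      obtain ⟨x, y, h, rfl⟩ := Butterfly.exists_cls _ _ z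
      exact (hX x).trans ((hX x).symm.trans (h.trans (hY y).symm)))
    (fun z => by
      obtain ⟨x, y, h, rfl⟩ := Butterfly.exists_cls _ _ z
      exact h.symm.trans (hX x))

/-- The symmetry of `Eq(I_ξ)`. -/
instance selfEquivSymmetric (ξ : C →* MulAut B) : SymmetricCategory (SelfEquiv ξ) where
  braiding X Y := (isSelfEquivalence ξ).isoMk (Butterfly.toIso (swapHom ξ X Y))
  braiding_naturality_right X Y Z f := ObjectProperty.hom_ext _ <| Butterfly.Hom.ext' fun z => by
    obtain ⟨x, y, h, rfl⟩ := Butterfly.exists_cls _ _ z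
    rfl
  braiding_naturality_left f Z := ObjectProperty.hom_ext _ <| Butterfly.Hom.ext' fun z => by
    obtain ⟨x, y, h, rfl⟩ := Butterfly.exists_cls _ _ z
    rfl
  hexagon_forward X Y Z := ObjectProperty.hom_ext _ <| Butterfly.Hom.ext' fun w => by
    obtain ⟨w, z, h, rfl⟩ := Butterfly.exists_cls _ _ w
    obtain ⟨x, y, h', rfl⟩ := Butterfly.exists_cls _ _ w
    have h₁ : Butterfly.γ Y.obj y = Butterfly.δ Z.obj z := h
    have h₂ : Butterfly.γ X.obj x = Butterfly.δ Z.obj z :=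
      (h'.trans (congrFun (congrArg DFunLike.coe Y.property.1) y).symm).trans h₁
    have h₃ : Butterfly.γ Z.obj z = Butterfly.δ X.obj x :=
      (congrFun (congrArg DFunLike.coe Z.property.1) z).trans
        (h₂.symm.trans (congrFun (congrArg DFunLike.coe X.property.1) x))
    have h₄ : Butterfly.γ Y.obj y = Butterfly.δ X.obj x :=
      h₁.trans (h₂.symm.trans (congrFun (congrArg DFunLike.coe X.property.1) x))
    have e1 := Butterfly.assoc_cls X.obj Y.obj Z.obj (x := x) (h := h') h₁
    have e2 := Butterfly.assoc_cls Y.obj Z.obj X.obj (x := y) (y := z) (z := x) (h := h₁) h₃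
    have e3 := Butterfly.assoc_cls Y.obj X.obj Z.obj (x := y) (y := x) (z := z) (h := h₄) h₂
    exact (congrArg (fun v => (Butterfly.assoc Y.obj Z.obj X.obj).σ
      ((swapHom ξ X (Y ⊗ Z)).σ v)) e1).trans (e2.trans
        (congrArg (Butterfly.compMap (𝟙 Y.obj) (swapHom ξ X Z)).σ e3).symm)
  hexagon_reverse X Y Z := ObjectProperty.hom_ext _ <| Butterfly.Hom.ext' fun w => by
    obtain ⟨x, w, h, rfl⟩ := Butterfly.exists_cls _ _ w
    obtain ⟨y, z, h', rfl⟩ := Butterfly.exists_cls _ _ w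
    have h₁ : Butterfly.γ X.obj x = Butterfly.δ Y.obj y := h
    have h₂ : Butterfly.γ X.obj x = Butterfly.δ Z.obj z :=
      (h₁.trans (congrFun (congrArg DFunLike.coe Y.property.1) y).symm).trans h'
    have h₃ : Butterfly.γ Z.obj z = Butterfly.δ X.obj x :=
      (congrFun (congrArg DFunLike.coe Z.property.1) z).trans
        (h₂.symm.trans (congrFun (congrArg DFunLike.coe X.property.1) x))
    have h₄ : Butterfly.γ Z.obj z = Butterfly.δ Y.obj y :=
      h₃.trans ((congrFun (congrArg DFunLike.coe X.property.1) x).symm.trans h₁)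
    have e1 := Butterfly.assoc_inv_cls X.obj Y.obj Z.obj (x := x) h₁ h'
    have e2 := Butterfly.assoc_inv_cls Z.obj X.obj Y.obj (x := z) h₃ h₁
    have e3 := Butterfly.assoc_inv_cls X.obj Z.obj Y.obj (x := x) h₂ h₄
    exact (congrArg (fun v => (Butterfly.assoc Z.obj X.obj Y.obj).σ.symm
      ((swapHom ξ (X ⊗ Y) Z).σ v)) e1).trans (e2.trans
        (congrArg (Butterfly.compMap (swapHom ξ X Z) (𝟙 Y.obj)).σ e3).symm)
  symmetry X Y := ObjectProperty.hom_ext _ <| Butterfly.Hom.ext' fun z => by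
    obtain ⟨x, y, h, rfl⟩ := Butterfly.exists_cls _ _ z
    rfl

end SelfEquivalences

/-! ### Abelian extensions and their Baer sum -/

/-- An abelian extension `1 → B → E → C → 1` which induces the action `ξ` on its kernel. -/
structure OpExt {C B : Type u} [Group C] [CommGroup B] (ξ : C →* MulAut B) where
  /-- the extension group -/
  E : Type u
  [group : Group E]
  /-- the short exact sequence -/
  ext : GroupExtension B E C
  conj : ∀ e b, ext.inl (ξ (ext.rightHom e) b) = e * ext.inl b * e⁻¹

attribute [instance] OpExt.group

namespace OpExt

variable {C B : Type u} [Group C] [CommGroup B] {ξ : C →* MulAut B}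

/-- The inclusion of the kernel. -/
abbrev κ (X : OpExt ξ) : B →* X.E := X.ext.inl

/-- The projection. -/
abbrev γ (X : OpExt ξ) : X.E →* C := X.ext.rightHom

theorem γ_κ (X : OpExt ξ) (b : B) : X.γ (X.κ b) = 1 := X.ext.rightHom_inl b

theorem exists_κ (X : OpExt ξ) {x : X.E} (h : X.γ x = 1) : ∃ a, X.κ a = x := by
  have : x ∈ X.κ.range := X.ext.range_inl_eq_ker_rightHom ▸ h
  exact this

theorem κ_comm (X : OpExt ξ) (x : X.E) (b : B) : X.κ (ξ (X.γ x) b) * x = x * X.κ b := by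
  rw [X.conj]; simp

theorem κ_comm' (X : OpExt ξ) (b c : B) : X.κ b * X.κ c = X.κ c * X.κ b := by
  rw [← map_mul, mul_comm, map_mul]

/-- A morphism of extensions which is the identity on `B` and on `C`. -/
structure Hom (X Y : OpExt ξ) where
  /-- the homomorphism of the extension groups -/
  toHom : X.E →* Y.E
  toHom_κ : ∀ b, toHom (X.κ b) = Y.κ b
  γ_toHom : ∀ x, Y.γ (toHom x) = X.γ x

theorem Hom.ext' {X Y : OpExt ξ} {s t : Hom X Y} (h : ∀ x, s.toHom x = t.toHom x) : s = t := by
  cases s; cases t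
  congr 1
  exact MonoidHom.ext h

instance category : Category.{u} (OpExt ξ) where
  Hom := Hom
  id X := ⟨MonoidHom.id _, fun _ => rfl, fun _ => rfl⟩
  comp s t := ⟨t.toHom.comp s.toHom, fun b => by simp [s.toHom_κ, t.toHom_κ],
    fun x => by simp [t.γ_toHom, s.γ_toHom]⟩
  id_comp _ := rfl
  comp_id _ := rfl
  assoc _ _ _ := rfl

/-- Short five lemma. -/
theorem Hom.bijective {X Y : OpExt ξ} (f : Hom X Y) : Function.Bijective f.toHom := by
  constructor
  · rw [injective_iff_map_eq_one]
    intro x hx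
    obtain ⟨a, rfl⟩ := X.exists_κ (x := x) (by rw [← f.γ_toHom, hx, map_one])
    rw [f.toHom_κ] at hx
    rw [(injective_iff_map_eq_one _).1 Y.ext.inl_injective a hx, map_one]
  · intro y
    obtain ⟨x, hx⟩ := X.ext.rightHom_surjective (Y.γ y)
    obtain ⟨a, ha⟩ := Y.exists_κ (x := y * (f.toHom x)⁻¹) (by
      rw [map_mul, map_inv, f.γ_toHom, ← hx, mul_inv_cancel])
    exact ⟨X.κ a * x, by rw [map_mul, f.toHom_κ, ha, inv_mul_cancel_right]⟩

/-- The underlying isomorphism of groups of a morphism of extensions. -/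
def Hom.σ {X Y : OpExt ξ} (f : Hom X Y) : X.E ≃* Y.E := MulEquiv.ofBijective f.toHom f.bijective

/-- Every morphism of extensions is invertible. -/
def toIso {X Y : OpExt ξ} (f : Hom X Y) : X ≅ Y where
  hom := f
  inv := ⟨f.σ.symm.toMonoidHom, fun b => f.σ.symm_apply_eq.2 (f.toHom_κ b).symm, fun y => by
    obtain ⟨x, rfl⟩ := f.σ.surjective y
    exact (congrArg X.γ (f.σ.symm_apply_apply x)).trans (f.γ_toHom x).symm⟩
  hom_inv_id := Hom.ext' fun x => f.σ.symm_apply_apply x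
  inv_hom_id := Hom.ext' fun x => f.σ.apply_symm_apply x

/-- The semidirect product extension `B → B ⋊ C → C`. -/
def semidirect (ξ : C →* MulAut B) : OpExt ξ where
  E := B ⋊[ξ] C
  ext := SemidirectProduct.toGroupExtension ξ
  conj e b := by
    apply SemidirectProduct.ext
    · simp [SemidirectProduct.toGroupExtension, mul_comm]
    · simp [SemidirectProduct.toGroupExtension]

/-- The pullback `E ×_C E'` of two extensions along the diagonal of `C`. -/
def fib (X Y : OpExt ξ) : Subgroup (X.E × Y.E) :=
  (X.γ.comp (MonoidHom.fst X.E Y.E)).eqLocus (Y.γ.comp (MonoidHom.snd X.E Y.E))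

/-- The kernel `κ ×_C κ' : B × B → E ×_C E'` of the pulled back extension. -/
def fibKer (X Y : OpExt ξ) : B × B →* X.fib Y :=
  (MonoidHom.prodMap X.κ Y.κ).codRestrict (X.fib Y) fun b =>
    (X.γ_κ b.1).trans (Y.γ_κ b.2).symm

/-- The codiagonal `[1, 1] : B × B → B`. -/
def codiag (B : Type u) [CommGroup B] : B × B →* B :=
  MonoidHom.coprod (MonoidHom.id B) (MonoidHom.id B)

instance fibKer_normal (X Y : OpExt ξ) : ((codiag B).ker.map (X.fibKer Y)).Normal where
  conj_mem := by
    rintro _ ⟨⟨a, b⟩, hab, rfl⟩ ⟨⟨x, y⟩, h⟩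
    have h' : X.γ x = Y.γ y := h
    have hab' : a * b = 1 := hab
    refine ⟨(ξ (X.γ x) a, ξ (X.γ x) b), ?_, Subtype.ext (Prod.ext (X.conj x a) ?_)⟩
    · change ξ (X.γ x) a * ξ (X.γ x) b = 1
      rw [← map_mul, hab', map_one]
    · exact (congrArg (fun z => Y.κ (ξ z b)) h').trans (Y.conj y b)

/-- The group of the Baer sum. It is the pushforward of `κ ×_C κ'` along the codiagonal of `B`:
since the codiagonal is onto, this is the quotient of `E ×_C E'` by the image of its kernel,
see `baer_isPushout`. -/
abbrev BaerGroup (X Y : OpExt ξ) : Type u := X.fib Y ⧸ (codiag B).ker.map (X.fibKer Y)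

/-- The class of `(x, y)` in the group of the Baer sum. -/
def cls (X Y : OpExt ξ) (x : X.E) (y : Y.E) (h : X.γ x = Y.γ y) : X.BaerGroup Y :=
  QuotientGroup.mk ⟨(x, y), h⟩

theorem exists_cls (X Y : OpExt ξ) (z : X.BaerGroup Y) : ∃ x y h, z = X.cls Y x y h := by
  induction z using QuotientGroup.induction_on with
  | H z => exact ⟨z.1.1, z.1.2, z.2, rfl⟩

theorem cls_mul (X Y : OpExt ξ) {x y h x' y' h'} :
    X.cls Y x y h * X.cls Y x' y' h' = X.cls Y (x * x') (y * y')
      (by rw [map_mul, map_mul, h, h']) := rfl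

theorem cls_eq_cls (X Y : OpExt ξ) {x y h x' y' h'} :
    X.cls Y x y h = X.cls Y x' y' h' ↔ ∃ a, x * X.κ a = x' ∧ y * (Y.κ a)⁻¹ = y' := by
  unfold cls
  rw [QuotientGroup.eq]
  constructor
  · rintro ⟨⟨a, b⟩, hab, ha⟩
    have h1 : X.κ a = x⁻¹ * x' := congrArg (fun z => z.1.1) ha
    have h2 : Y.κ b = y⁻¹ * y' := congrArg (fun z => z.1.2) ha
    have hab' : a * b = 1 := hab
    obtain rfl : b = a⁻¹ := (inv_eq_of_mul_eq_one_right hab').symm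
    exact ⟨a, by rw [h1, mul_inv_cancel_left], by rw [← map_inv, h2, mul_inv_cancel_left]⟩
  · rintro ⟨a, rfl, rfl⟩
    refine ⟨(a, a⁻¹), mul_inv_cancel a, Subtype.ext (Prod.ext (inv_mul_cancel_left x _).symm ?_)⟩
    exact (map_inv Y.κ a).trans (inv_mul_cancel_left y _).symm

theorem cls_eq_one (X Y : OpExt ξ) {x y h} :
    X.cls Y x y h = 1 ↔ ∃ a, X.κ a = x ∧ (Y.κ a)⁻¹ = y := by
  have : (1 : X.BaerGroup Y) = X.cls Y 1 1 (by simp) := rfl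
  rw [this, eq_comm, cls_eq_cls]
  simp

theorem cls_congr (X Y : OpExt ξ) {x x' y y' h h'} (hx : x = x') (hy : y = y') :
    X.cls Y x y h = X.cls Y x' y' h' := by
  subst hx hy
  rfl

/-- The inclusion of `B` in the Baer sum. -/
def baerInl (X Y : OpExt ξ) : B →* X.BaerGroup Y :=
  MonoidHom.mk' (fun b => X.cls Y 1 (Y.κ b) (by rw [map_one, Y.γ_κ])) fun a b => by
    rw [cls_mul]
    exact cls_congr X Y (one_mul 1).symm (map_mul Y.κ a b)

/-- The Baer sum of two abelian extensions. -/
def baer (X Y : OpExt ξ) : OpExt ξ where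
  E := X.BaerGroup Y
  ext :=
    { inl := X.baerInl Y
      rightHom := QuotientGroup.lift _
        (X.γ.comp ((MonoidHom.fst X.E Y.E).comp (X.fib Y).subtype)) <| by
          rintro _ ⟨b, _, rfl⟩
          exact X.γ_κ b.1
      inl_injective := by
        rw [injective_iff_map_eq_one]
        intro b hb
        obtain ⟨a, h1, h2⟩ := (X.cls_eq_one Y).1 hb
        obtain rfl : a = 1 := X.ext.inl_injective (by rw [h1, map_one])
        exact Y.ext.inl_injective (by rw [← h2, map_one, inv_one])
      range_inl_eq_ker_rightHom := by
        ext z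
        constructor
        · rintro ⟨b, rfl⟩
          exact map_one X.γ
        · intro hz
          obtain ⟨x, y, h, rfl⟩ := X.exists_cls Y z
          obtain ⟨a, rfl⟩ := X.exists_κ (x := x) hz
          obtain ⟨b, rfl⟩ := Y.exists_κ (x := y) (by rw [← h, X.γ_κ])
          refine ⟨a * b, (X.cls_eq_cls Y).2 ⟨a, one_mul _, ?_⟩⟩
          rw [← map_inv, ← map_mul, mul_inv_cancel_comm]
      rightHom_surjective := fun c => by
        obtain ⟨x, hx⟩ := X.ext.rightHom_surjective c
        obtain ⟨y, hy⟩ := Y.ext.rightHom_surjective c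
        exact ⟨X.cls Y x y (hx.trans hy.symm), hx⟩ }
  conj z b := by
    obtain ⟨x, y, h, rfl⟩ := X.exists_cls Y z
    rw [eq_mul_inv_iff_mul_eq]
    refine X.cls_congr Y ((one_mul x).trans (mul_one x).symm) ?_
    exact (congrArg (fun c => Y.κ (ξ c b) * y) h).trans (Y.κ_comm y b)

/-- The square exhibiting the Baer sum as the pushforward of `κ ×_C κ'` along the codiagonal
commutes and is universal among commutative squares of groups. -/
theorem baer_isPushout (X Y : OpExt ξ) :
    (∀ b, (QuotientGroup.mk (X.fibKer Y b) : X.BaerGroup Y) = (X.baer Y).κ (codiag B b)) ∧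
    ∀ (H : Type u) [Group H] (f : X.fib Y →* H) (g : B →* H),
      (∀ b, f (X.fibKer Y b) = g (codiag B b)) →
      ∃! k : X.BaerGroup Y →* H, (∀ t, k (QuotientGroup.mk t) = f t) ∧
        ∀ b, k ((X.baer Y).κ b) = g b := by
  constructor
  · rintro ⟨a, b⟩
    refine (X.cls_eq_cls Y (h := (X.fibKer Y (a, b)).2)).2 ⟨a⁻¹, ?_, ?_⟩
    · change X.κ a * X.κ a⁻¹ = 1
      rw [← map_mul, mul_inv_cancel, map_one]
    · change Y.κ b * (Y.κ a⁻¹)⁻¹ = Y.κ (a * b)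
      rw [← map_inv, inv_inv, ← map_mul, mul_comm]
  · intro H _ f g hfg
    refine ⟨QuotientGroup.lift _ f ?_, ⟨fun _ => rfl, fun b => ?_⟩, ?_⟩
    · rintro _ ⟨b, hb, rfl⟩
      rw [MonoidHom.mem_ker, hfg, show codiag B b = 1 from hb, map_one]
    · have h := hfg (1, b)
      rw [show codiag B (1, b) = b from one_mul b] at h
      have e : (1 : X.E) = X.κ 1 := (map_one X.κ).symm
      exact Eq.trans (congrArg f (a₂ := X.fibKer Y (1, b)) (Subtype.ext (Prod.ext e rfl))) h
    · rintro k ⟨hk, _⟩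
      ext t
      exact hk t

/-- Homomorphisms out of the Baer sum. -/
def descHom (X Y : OpExt ξ) {H : Type u} [Group H]
    (f : ∀ x y, X.γ x = Y.γ y → H)
    (hf : ∀ x y h x' y' h' h'', f (x * x') (y * y') h'' = f x y h * f x' y' h')
    (h1 : ∀ a h, f (X.κ a) (Y.κ a)⁻¹ h = 1) : X.BaerGroup Y →* H :=
  QuotientGroup.lift _ (MonoidHom.mk' (fun z : X.fib Y => f z.1.1 z.1.2 z.2)
    fun z w => hf _ _ _ _ _ _ _) <| by
      rintro _ ⟨⟨a, b⟩, hab, rfl⟩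
      obtain rfl : b = a⁻¹ := (inv_eq_of_mul_eq_one_right hab).symm
      refine Eq.trans ?_ (h1 a (by rw [map_inv, X.γ_κ, Y.γ_κ, inv_one]))
      have : ∀ y y' h h', y = y' → f (X.κ a) y h = f (X.κ a) y' h' := by
        rintro y y' h h' rfl
        rfl
      exact this _ _ _ _ (map_inv Y.κ a)

/-- The Baer sum is functorial: `(x, y) ↦ (s x, t y)`. -/
def baerMap {X X' Y Y' : OpExt ξ} (s : Hom X X') (t : Hom Y Y') : Hom (X.baer Y) (X'.baer Y') where
  toHom := descHom X Y (fun x y h => X'.cls Y' (s.toHom x) (t.toHom y)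
      (by rw [s.γ_toHom, t.γ_toHom, h]))
    (by intros; simp only [map_mul]; rfl)
    fun a _ => (cls_eq_one _ _).2
      ⟨a, (s.toHom_κ a).symm, by rw [map_inv, t.toHom_κ]⟩
  toHom_κ b := cls_congr _ _ (map_one s.toHom) (t.toHom_κ b)
  γ_toHom z := by
    obtain ⟨x, y, h, rfl⟩ := exists_cls _ _ z
    exact s.γ_toHom x

/-- The left unitor `((b, c), x) ↦ κ(b) x`. -/
def leftUnit (X : OpExt ξ) : Hom ((semidirect ξ).baer X) X where
  toHom := descHom (semidirect ξ) X (fun x y _ => X.κ x.left * y)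
    (by
      intro x y h x' y' h' _
      have h2 : x.right = X.γ y := h
      change X.κ (x.left * ξ x.right x'.left) * (y * y') = _
      rw [h2, map_mul, mul_assoc, ← mul_assoc _ y, X.κ_comm, mul_assoc, mul_assoc])
    (fun a _ => mul_inv_cancel (X.κ a))
  toHom_κ b := by
    change X.κ 1 * X.κ b = X.κ b
    rw [map_one, one_mul]
  γ_toHom z := by
    obtain ⟨x, y, h, rfl⟩ := exists_cls _ _ z
    change X.γ (X.κ x.left * y) = x.right
    rw [map_mul, X.γ_κ, one_mul]
    exact h.symm

/-- The right unitor `(x, (b, c)) ↦ κ(b) x`. -/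
def rightUnit (X : OpExt ξ) : Hom (X.baer (semidirect ξ)) X where
  toHom := descHom X (semidirect ξ) (fun x y _ => X.κ y.left * x)
    (by
      intro x y h x' y' h' _
      have h2 : X.γ x = y.right := h
      change X.κ (y.left * ξ y.right y'.left) * (x * x') = _
      rw [← h2, map_mul, mul_assoc, ← mul_assoc _ x, X.κ_comm, mul_assoc, mul_assoc])
    (fun a _ => by
      change X.κ (ξ 1⁻¹ a⁻¹) * X.κ a = 1
      rw [inv_one, map_one, MulAut.one_apply, ← map_mul, inv_mul_cancel, map_one])
  toHom_κ b := by
    change X.κ b * 1 = X.κ b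
    rw [mul_one]
  γ_toHom z := by
    obtain ⟨x, y, h, rfl⟩ := exists_cls _ _ z
    change X.γ (X.κ y.left * x) = X.γ x
    rw [map_mul, X.γ_κ, one_mul]

/-- The pullback over `C` of three extensions. -/
def fib₃ (X Y Z : OpExt ξ) : Subgroup (X.E × Y.E × Z.E) where
  carrier := {t | X.γ t.1 = Y.γ t.2.1 ∧ Y.γ t.2.1 = Z.γ t.2.2}
  mul_mem' := by rintro a b ⟨h, h'⟩ ⟨k, k'⟩; simp [h, h', k, k']
  one_mem' := by simp
  inv_mem' := by rintro a ⟨h, h'⟩; simp [h, h']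

/-- The cover of `(X ⊕ Y) ⊕ Z` by the iterated pullback. -/
def cover (X Y Z : OpExt ξ) : X.fib₃ Y Z →* (X.baer Y).BaerGroup Z :=
  MonoidHom.mk' (fun t => (X.baer Y).cls Z (X.cls Y t.1.1 t.1.2.1 t.2.1) t.1.2.2
    (t.2.1.trans t.2.2)) fun _ _ => rfl

/-- The cover of `X ⊕ (Y ⊕ Z)` by the iterated pullback. -/
def cover' (X Y Z : OpExt ξ) : X.fib₃ Y Z →* X.BaerGroup (Y.baer Z) :=
  MonoidHom.mk' (fun t => X.cls (Y.baer Z) t.1.1 (Y.cls Z t.1.2.1 t.1.2.2 t.2.2) t.2.1)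
    fun _ _ => rfl

theorem cover_surjective (X Y Z : OpExt ξ) : Function.Surjective (cover X Y Z) := fun w => by
  obtain ⟨w, z, h, rfl⟩ := exists_cls _ _ w
  obtain ⟨x, y, h', rfl⟩ := exists_cls _ _ w
  exact ⟨⟨(x, y, z), h', h'.symm.trans h⟩, rfl⟩

theorem cover_ker_le (X Y Z : OpExt ξ) : (cover X Y Z).ker ≤ (cover' X Y Z).ker := by
  rintro ⟨⟨x, y, z⟩, h, h'⟩ hw
  obtain ⟨a, h1, h2⟩ := (cls_eq_one _ _).1 (MonoidHom.mem_ker.1 hw)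
  obtain ⟨b, h3, h4⟩ := (cls_eq_cls _ _).1 h1
  refine (cls_eq_one _ _).2 ⟨b, (one_mul _).symm.trans h3, ?_⟩
  refine (map_inv (Y.baer Z).κ b).symm.trans ((cls_eq_cls Y Z).2 ⟨a * b⁻¹, ?_, ?_⟩)
  · refine Eq.trans ?_ h4
    rw [one_mul, map_mul, map_inv]
  · refine Eq.trans ?_ h2
    rw [← map_inv, ← map_inv, ← map_mul]
    congr 1
    group

/-- The associator `((x, y), z) ↦ (x, (y, z))`. -/
def assoc (X Y Z : OpExt ξ) : Hom ((X.baer Y).baer Z) (X.baer (Y.baer Z)) :=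
  have key : ∀ t, (cover X Y Z).liftOfSurjective (cover_surjective X Y Z)
      ⟨cover' X Y Z, cover_ker_le X Y Z⟩ (cover X Y Z t) = cover' X Y Z t := fun t =>
    MonoidHom.liftOfRightInverse_comp_apply _ _
      (Function.rightInverse_surjInv (cover_surjective X Y Z)) _ t
  { toHom := (cover X Y Z).liftOfSurjective (cover_surjective X Y Z)
      ⟨cover' X Y Z, cover_ker_le X Y Z⟩
    toHom_κ := fun b => key ⟨(1, 1, Z.κ b), by simp, by simp [Z.γ_κ]⟩
    γ_toHom := fun w => by
      obtain ⟨t, rfl⟩ := cover_surjective X Y Z w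
      exact congrArg (X.baer (Y.baer Z)).γ (key t) }

theorem assoc_cls (X Y Z : OpExt ξ) {x y z} (h : X.γ x = Y.γ y) (h' : Y.γ y = Z.γ z) :
    (assoc X Y Z).toHom ((X.baer Y).cls Z (X.cls Y x y h) z (h.trans h')) =
      X.cls (Y.baer Z) x (Y.cls Z y z h') h :=
  MonoidHom.liftOfRightInverse_comp_apply _ _
    (Function.rightInverse_surjInv (cover_surjective X Y Z)) _
      (⟨(x, y, z), h, h'⟩ : X.fib₃ Y Z)

theorem assoc_inv_cls (X Y Z : OpExt ξ) {x y z} (h : X.γ x = Y.γ y) (h' : Y.γ y = Z.γ z) :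
    (assoc X Y Z).σ.symm (X.cls (Y.baer Z) x (Y.cls Z y z h') h) =
      (X.baer Y).cls Z (X.cls Y x y h) z (h.trans h') :=
  (MulEquiv.symm_apply_eq _).2 (assoc_cls X Y Z h h').symm

theorem eq_conj {F F' G G' : OpExt ξ} {s : F ⟶ F'} {t : G ⟶ G'}
    {u : Hom F G} {v : Hom F' G'} (h : ∀ x, v.toHom (Hom.toHom s x) = Hom.toHom t (u.toHom x)) :
    s = (toIso u).hom ≫ t ≫ (toIso v).inv := by
  rw [← Category.assoc, Iso.eq_comp_inv]
  exact Hom.ext' h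

/-- The swap `(x, y) ↦ (y, x)`. -/
def swapHom (X Y : OpExt ξ) : Hom (X.baer Y) (Y.baer X) where
  toHom := descHom X Y (fun x y h => Y.cls X y x h.symm) (fun _ _ _ _ _ _ _ => rfl)
    fun a _ => (cls_eq_one _ _).2 ⟨a⁻¹, map_inv _ _, by rw [map_inv, inv_inv]⟩
  toHom_κ b := (cls_eq_cls _ _).2 ⟨b⁻¹,
    (congrArg (_ * ·) (map_inv Y.κ b)).trans (mul_inv_cancel _),
    (one_mul _).trans (by rw [map_inv, inv_inv])⟩
  γ_toHom z := by
    obtain ⟨x, y, h, rfl⟩ := exists_cls _ _ z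
    exact h.symm

/-- The monoidal structure of the second cohomology 2-group: the tensor product is the Baer sum
and the unit is the semidirect product extension. -/
instance monoidalCategory : MonoidalCategory (OpExt ξ) where
  tensorObj X Y := X.baer Y
  whiskerLeft X _ _ t := baerMap (𝟙 X) t
  whiskerRight s Y := baerMap s (𝟙 Y)
  tensorHom s t := baerMap s t
  tensorUnit := semidirect ξ
  associator X Y Z := toIso (assoc X Y Z)
  leftUnitor X := toIso (leftUnit X)
  rightUnitor X := toIso (rightUnit X)
  tensorHom_def s t := Hom.ext' fun z => by
    obtain ⟨x, y, h, rfl⟩ := exists_cls _ _ z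
    rfl
  id_tensorHom_id X Y := Hom.ext' fun z => by
    obtain ⟨x, y, h, rfl⟩ := exists_cls _ _ z
    rfl
  tensorHom_comp_tensorHom s t s' t' := Hom.ext' fun z => by
    obtain ⟨x, y, h, rfl⟩ := exists_cls _ _ z
    rfl
  whiskerLeft_id X Y := Hom.ext' fun z => by
    obtain ⟨x, y, h, rfl⟩ := exists_cls _ _ z
    rfl
  id_whiskerRight X Y := Hom.ext' fun z => by
    obtain ⟨x, y, h, rfl⟩ := exists_cls _ _ z
    rfl
  associator_naturality {X Y Z X' Y' Z'} s t u := Hom.ext' fun w => by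
    obtain ⟨w, z, h, rfl⟩ := exists_cls _ _ w
    obtain ⟨x, y, h', rfl⟩ := exists_cls _ _ w
    have h₁ : X.γ x = Y.γ y := h'
    have h₂ : Y.γ y = Z.γ z := h'.symm.trans h
    exact (assoc_cls X' Y' Z' (x := s.toHom x) (y := t.toHom y) (z := u.toHom z)
      (by rw [s.γ_toHom, t.γ_toHom, h₁]) (by rw [t.γ_toHom, u.γ_toHom, h₂])).trans
        (congrArg (baerMap s (baerMap t u)).toHom (assoc_cls X Y Z h₁ h₂)).symm
  leftUnitor_naturality {X Y} s := Hom.ext' fun z => by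
    obtain ⟨x, y, h, rfl⟩ := exists_cls _ _ z
    change Y.κ _ * s.toHom y = s.toHom (X.κ _ * y)
    rw [map_mul, s.toHom_κ]
    rfl
  rightUnitor_naturality {X Y} s := Hom.ext' fun z => by
    obtain ⟨x, y, h, rfl⟩ := exists_cls _ _ z
    change Y.κ _ * s.toHom x = s.toHom (X.κ _ * x)
    rw [map_mul, s.toHom_κ]
    rfl
  pentagon X Y Z W := Hom.ext' fun v => by
    obtain ⟨v, t, h₁, rfl⟩ := exists_cls _ _ v
    obtain ⟨w, z, h₂, rfl⟩ := exists_cls _ _ v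
    obtain ⟨x, y, h₃, rfl⟩ := exists_cls _ _ w
    have a : X.γ x = Y.γ y := h₃
    have b : Y.γ y = Z.γ z := h₃.symm.trans h₂
    have c : Z.γ z = W.γ t := b.symm.trans (a.symm.trans h₁)
    have e1 : (baerMap (assoc X Y Z) (𝟙 W)).toHom
        (((X.baer Y).baer Z).cls W ((X.baer Y).cls Z (X.cls Y x y h₃) z h₂) t h₁) =
        (X.baer (Y.baer Z)).cls W (X.cls (Y.baer Z) x (Y.cls Z y z b) a) t h₁ :=
      cls_congr (X.baer (Y.baer Z)) W (assoc_cls X Y Z a b) rfl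
    have e2 := assoc_cls X (Y.baer Z) W (x := x) (y := Y.cls Z y z b) (z := t) a (b.trans c)
    have e3 : (baerMap (𝟙 X) (assoc Y Z W)).toHom
        (X.cls ((Y.baer Z).baer W) x ((Y.baer Z).cls W (Y.cls Z y z b) t (b.trans c)) a) =
        X.cls (Y.baer (Z.baer W)) x (Y.cls (Z.baer W) y (Z.cls W z t c) b) a :=
      cls_congr X (Y.baer (Z.baer W)) rfl (assoc_cls Y Z W b c)
    have e4 := assoc_cls (X.baer Y) Z W (x := X.cls Y x y a) (y := z) (z := t) h₂ c
    have e5 := assoc_cls X Y (Z.baer W) (x := x) (y := y) (z := Z.cls W z t c) a b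
    exact ((congrArg _ ((congrArg _ e1).trans e2)).trans e3).trans
      ((congrArg (assoc X Y (Z.baer W)).toHom e4).trans e5).symm
  triangle X Y := Hom.ext' fun w => by
    obtain ⟨w, z, h, rfl⟩ := exists_cls _ _ w
    obtain ⟨x, y, h', rfl⟩ := exists_cls _ _ w
    have h₂ : (semidirect ξ).γ y = Y.γ z := h'.symm.trans h
    refine (congrArg (baerMap (𝟙 X) (leftUnit Y)).toHom
      (assoc_cls X (semidirect ξ) Y h' h₂)).trans ?_
    refine (cls_eq_cls X Y).2 ⟨ξ (X.γ x)⁻¹ (SemidirectProduct.left y), ?_, ?_⟩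
    · change x * X.κ _ = X.κ _ * x
      rw [← X.κ_comm, map_inv, MulAut.apply_inv_self]
    · change Y.κ _ * z * (Y.κ _)⁻¹ = z
      have h₃ : X.γ x = Y.γ z := h
      rw [mul_inv_eq_iff_eq_mul, ← Y.κ_comm, h₃, map_inv, MulAut.apply_inv_self]

/-- The symmetry of the second cohomology 2-group. -/
instance symmetricCategory : SymmetricCategory (OpExt ξ) where
  braiding X Y := toIso (swapHom X Y)
  braiding_naturality_right X Y Z f := Hom.ext' fun z => by
    obtain ⟨x, y, h, rfl⟩ := exists_cls _ _ z
    rfl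
  braiding_naturality_left f Z := Hom.ext' fun z => by
    obtain ⟨x, y, h, rfl⟩ := exists_cls _ _ z
    rfl
  hexagon_forward X Y Z := Hom.ext' fun w => by
    obtain ⟨w, z, h, rfl⟩ := exists_cls _ _ w
    obtain ⟨x, y, h', rfl⟩ := exists_cls _ _ w
    have a : X.γ x = Y.γ y := h'
    have b : Y.γ y = Z.γ z := h'.symm.trans h
    have e1 := assoc_cls X Y Z a b
    have e2 := assoc_cls Y Z X b (b.symm.trans a.symm)
    have e3 := assoc_cls Y X Z a.symm (a.trans b)
    exact (congrArg (fun v => (assoc Y Z X).toHom ((swapHom X (Y.baer Z)).toHom v)) e1).trans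
      (e2.trans (congrArg (baerMap (𝟙 Y) (swapHom X Z)).toHom e3).symm)
  hexagon_reverse X Y Z := Hom.ext' fun w => by
    obtain ⟨x, w, h, rfl⟩ := exists_cls _ _ w
    obtain ⟨y, z, h', rfl⟩ := exists_cls _ _ w
    have a : X.γ x = Y.γ y := h
    have b : Y.γ y = Z.γ z := h'
    have e1 := assoc_inv_cls X Y Z a b
    have e2 := assoc_inv_cls Z X Y (b.symm.trans a.symm) a
    have e3 := assoc_inv_cls X Z Y (a.trans b) b.symm
    exact (congrArg (fun v => (assoc Z X Y).σ.symm ((swapHom (X.baer Y) Z).toHom v)) e1).trans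
      (e2.trans (congrArg (baerMap (swapHom X Z) (𝟙 Y)).toHom e3).symm)
  symmetry X Y := Hom.ext' fun z => by
    obtain ⟨x, y, h, rfl⟩ := exists_cls _ _ z
    rfl

end OpExt

/-! ### The comparison functor -/

section Comparison

variable {C B : Type u} [Group C] [CommGroup B]

/-- The butterfly from `I_ξ` to itself with wings `κ⁻¹, κ` on the left and `γ, γ` on the right
associated with an abelian extension `(κ, γ)`. -/
def extensionButterfly (ξ : C →* MulAut B) (X : OpExt ξ) :
    Butterfly (unitCrossedExt ξ) (unitCrossedExt ξ) where
  F := X.E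
  κ := X.κ.comp invMonoidHom
  γ := X.γ
  δ := X.γ
  ι := X.κ
  δ_κ x := X.γ_κ x⁻¹
  γ_ι x := X.γ_κ x
  p_δ _ := rfl
  γ_κ x := X.γ_κ x⁻¹
  ι_injective := X.ext.inl_injective
  exact := X.ext.range_inl_eq_ker_rightHom
  δ_surjective := X.ext.rightHom_surjective
  κ_act f x := (congrArg X.κ (map_inv (ξ (X.γ f)) x).symm).trans (X.conj f x⁻¹)
  ι_act f x := X.conj f x

/-- The comparison `Φ` from abelian extensions to self-equivalences of `I_ξ`. -/
def Phi (ξ : C →* MulAut B) : OpExt ξ ⥤ SelfEquiv ξ where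
  obj X := ⟨extensionButterfly ξ X, rfl, fun b => map_inv X.κ b⟩
  map {X Y} f := ObjectProperty.homMk (Butterfly.homOfHom (F := extensionButterfly ξ X)
    (G := extensionButterfly ξ Y) (OpExt.Hom.toHom f) (OpExt.Hom.toHom_κ f)
    (fun b => OpExt.Hom.toHom_κ f b⁻¹) (OpExt.Hom.γ_toHom f) (OpExt.Hom.γ_toHom f))
  map_id _ := ObjectProperty.hom_ext _ <| Butterfly.Hom.ext' fun _ => rfl
  map_comp _ _ := ObjectProperty.hom_ext _ <| Butterfly.Hom.ext' fun _ => rfl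

end Comparison

/-- A (not necessarily strict) 2-group: a monoidal groupoid in which every object is invertible
up to isomorphism. -/
def IsTwoGroup (G : Type*) [Category G] [MonoidalCategory G] : Prop :=
  IsGroupoid G ∧ ∀ X : G, ∃ Y : G, Nonempty (X ⊗ Y ≅ 𝟙_ G) ∧ Nonempty (Y ⊗ X ≅ 𝟙_ G)

/-- A monoidal functor is strict if it preserves the unit and the tensor product on the nose, with
the identities as its coherence isomorphisms. -/
def IsStrictMonoidal {G H : Type*} [Category G] [Category H] [MonoidalCategory G]
    [MonoidalCategory H] (F : G ⥤ H) [F.Monoidal] : Prop :=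
  (∃ h : 𝟙_ H = F.obj (𝟙_ G), Functor.LaxMonoidal.ε F = eqToHom h) ∧
    ∀ X Y : G, ∃ h : F.obj X ⊗ F.obj Y = F.obj (X ⊗ Y), Functor.LaxMonoidal.μ F X Y = eqToHom h

end

/-!
A self-equivalence of `I_ξ` is an abelian extension in disguise: its wings `γ = δ` coincide and its
wing `κ` is the inverse of `ι`, so it is determined by the short exact sequence `(ι, δ)`, and the
condition `ι_act` says that this extension induces the action `ξ`. This is why `Phi` is essentially
surjective. A morphism of extensions is the same homomorphism as an isomorphism of the associated
butterflies, so that `Phi` is fully faithful.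

Both the Baer sum of extensions and the composite of the associated butterflies are quotients of
the *same* fibre product `E ×_C E'`. The normal subgroups that are divided out are
`{(κ b, κ' b') | b b' = 1}` for the former and `{(κ b, κ' b⁻¹)}` for the latter; they are
equal, but not by definition (`range_skew_extensionButterfly`). Hence the two butterflies
`Φ(E) ⊗ Φ(E')` and `Φ(E ⊕ E')` are equal, and the resulting transport `eqToHom` sends the class of
`(x, y)` to the class of `(x, y)` (`Butterfly.exists_eqToHom_mk`). All coherence conditions can
therefore be checked on classes of tuples, where they hold by inspection.

The Baer inverse of `(κ, γ)` is `(κ⁻¹, γ)`: if `γ x = γ y`, then `x y⁻¹ = κ b` for a unique `b`, and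
the class of `(x, y)` is sent to `(b, γ x)` in the semidirect product. Invertibility of the objects
of `Eq(I_ξ)` is transported along `Phi`.
-/

/-! ### Inverses for the Baer sum -/

namespace OpExt

variable {C B : Type u} [Group C] [CommGroup B] {ξ : C →* MulAut B}

/-- The inverse of an abelian extension for the Baer sum: the inclusion of the kernel is composed
with the inversion of `B`. -/
def baerInv (X : OpExt ξ) : OpExt ξ where
  E := X.E
  ext :=
    { inl := X.κ.comp invMonoidHom
      rightHom := X.γ
      inl_injective := X.ext.inl_injective.comp inv_injective
      range_inl_eq_ker_rightHom := by
        rw [← X.ext.range_inl_eq_ker_rightHom]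
        ext x
        constructor
        · rintro ⟨b, rfl⟩
          exact ⟨b⁻¹, rfl⟩
        · rintro ⟨b, rfl⟩
          exact ⟨b⁻¹, congrArg X.κ (inv_inv b)⟩
      rightHom_surjective := X.ext.rightHom_surjective }
  conj e b := (congrArg X.κ (map_inv (ξ (X.γ e)) b).symm).trans (X.conj e b⁻¹)

theorem exists_κ_eq_mul_inv (X : OpExt ξ) {x y : X.E} (h : X.γ x = X.γ y) :
    ∃ b, X.κ b = x * y⁻¹ :=
  X.exists_κ (by rw [map_mul, map_inv, h, mul_inv_cancel])

/-- The contraction `(x, y) ↦ (b, γ x)` where `κ b = x y⁻¹`. The choice of `b` is harmless since `κ`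
is injective. -/
noncomputable def baerInvHom (X : OpExt ξ) : Hom (X.baer X.baerInv) (semidirect ξ) where
  toHom := descHom X X.baerInv
    (fun x y h => (⟨(X.exists_κ_eq_mul_inv (y := y) h).choose, X.γ x⟩ : B ⋊[ξ] C))
    (by
      intro x y h x' y' h' h''
      have e := (X.exists_κ_eq_mul_inv (y := y) h).choose_spec
      have e' := (X.exists_κ_eq_mul_inv (y := y') h').choose_spec
      have e'' := (X.exists_κ_eq_mul_inv (x := x * x') (y := y * y') h'').choose_spec
      refine SemidirectProduct.ext (X.ext.inl_injective ?_) (map_mul X.γ x x')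
      refine e''.trans (Eq.trans ?_ (map_mul X.κ _ _).symm)
      rw [X.conj, e, e']
      -- Both `x y⁻¹` and `x (x' y'⁻¹) x⁻¹` lie in the image of `B`, so they commute.
      have hc := X.κ_comm' (X.exists_κ_eq_mul_inv (y := y) h).choose
        (ξ (X.γ x) (X.exists_κ_eq_mul_inv (y := y') h').choose)
      rw [X.conj, e, e'] at hc
      rw [hc]
      -- Stated over `X.E` alone, as `y` and `y'` have the type `X.baerInv.E`.
      have key : ∀ a b c d : X.E, a * b * (c * d)⁻¹ = a * (b * d⁻¹) * a⁻¹ * (a * c⁻¹) := by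
        intros
        group
      exact key x x' y y')
    (by
      intro a h
      have h1 : X.γ (X.κ a) = X.γ (X.κ a⁻¹)⁻¹ := h
      have e := (X.exists_κ_eq_mul_inv h1).choose_spec
      refine SemidirectProduct.ext (X.ext.inl_injective (e.trans ?_)) (X.γ_κ a)
      rw [inv_inv, ← map_mul, mul_inv_cancel]
      rfl)
  toHom_κ b := by
    have h1 : X.γ 1 = X.γ (X.κ b⁻¹) := by rw [map_one, X.γ_κ]
    have e := (X.exists_κ_eq_mul_inv h1).choose_spec
    refine SemidirectProduct.ext (X.ext.inl_injective (e.trans ?_)) (map_one X.γ)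
    rw [one_mul, ← map_inv, inv_inv]
    rfl
  γ_toHom z := by
    obtain ⟨x, y, h, rfl⟩ := exists_cls _ _ z
    rfl

theorem isTwoGroup (ξ : C →* MulAut B) : IsTwoGroup (OpExt ξ) :=
  ⟨⟨fun f => (toIso f).isIso_hom⟩, fun X =>
    ⟨X.baerInv, ⟨toIso X.baerInvHom⟩, ⟨β_ X.baerInv X ≪≫ toIso X.baerInvHom⟩⟩⟩

end OpExt

/-! ### Transport along equalities of butterflies -/

/-- Two butterflies with the same central group and the same wings are equal, and transport along
this equality is the identity of the central group. -/
theorem Butterfly.exists_eqToHom {C : Type u} [Group C] {E E' : CrossedExt C} {T : Type u}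
    [Group T] {κ κ' : E.E₂ →* T} {γ γ' : T →* E'.E₁} {δ δ' : T →* E.E₁} {ι ι' : E'.E₂ →* T}
    {h₁ h₂ h₃ h₄ h₅ h₆ h₇ h₈ h₉ h₁' h₂' h₃' h₄' h₅' h₆' h₇' h₈' h₉'}
    (hκ : ∀ x, κ x = κ' x) (hγ : ∀ t, γ t = γ' t) (hδ : ∀ t, δ t = δ' t) (hι : ∀ x, ι x = ι' x) :
    ∃ h : (⟨T, κ, γ, δ, ι, h₁, h₂, h₃, h₄, h₅, h₆, h₇, h₈, h₉⟩ : Butterfly E E') =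
      ⟨T, κ', γ', δ', ι', h₁', h₂', h₃', h₄', h₅', h₆', h₇', h₈', h₉'⟩,
      ∀ t : T, Hom.σ (eqToHom h) t = t := by
  obtain rfl : κ = κ' := MonoidHom.ext hκ
  obtain rfl : γ = γ' := MonoidHom.ext hγ
  obtain rfl : δ = δ' := MonoidHom.ext hδ
  obtain rfl : ι = ι' := MonoidHom.ext hι
  exact ⟨rfl, fun _ => rfl⟩

/-- Two butterflies whose central groups are quotients of one group by equal subgroups, and whose
wings agree on representatives, are equal, and transport along this equality is the identity on
representatives. -/
theorem Butterfly.exists_eqToHom_mk {C : Type u} [Group C] {E E' : CrossedExt C} {T : Type u}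
    [Group T] {N N' : Subgroup T} [N.Normal] [N'.Normal] (hN : N = N')
    {κ : E.E₂ →* T ⧸ N} {γ : T ⧸ N →* E'.E₁} {δ : T ⧸ N →* E.E₁} {ι : E'.E₂ →* T ⧸ N}
    {h₁ h₂ h₃ h₄ h₅ h₆ h₇ h₈ h₉}
    {κ' : E.E₂ →* T ⧸ N'} {γ' : T ⧸ N' →* E'.E₁} {δ' : T ⧸ N' →* E.E₁} {ι' : E'.E₂ →* T ⧸ N'}
    {h₁' h₂' h₃' h₄' h₅' h₆' h₇' h₈' h₉'}
    (hκ : ∀ x, ∃ t : T, κ x = t ∧ κ' x = t) (hγ : ∀ t : T, γ t = γ' t)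
    (hδ : ∀ t : T, δ t = δ' t) (hι : ∀ x, ∃ t : T, ι x = t ∧ ι' x = t) :
    ∃ h : (⟨T ⧸ N, κ, γ, δ, ι, h₁, h₂, h₃, h₄, h₅, h₆, h₇, h₈, h₉⟩ : Butterfly E E') =
      ⟨T ⧸ N', κ', γ', δ', ι', h₁', h₂', h₃', h₄', h₅', h₆', h₇', h₈', h₉'⟩,
      ∀ t : T, Hom.σ (eqToHom h) (t : T ⧸ N) = (t : T ⧸ N') := by
  subst hN
  obtain ⟨h, hσ⟩ := Butterfly.exists_eqToHom
    (h₁ := h₁) (h₂ := h₂) (h₃ := h₃) (h₄ := h₄) (h₅ := h₅) (h₆ := h₆) (h₇ := h₇) (h₈ := h₈)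
    (h₉ := h₉) (h₁' := h₁') (h₂' := h₂') (h₃' := h₃') (h₄' := h₄') (h₅' := h₅') (h₆' := h₆')
    (h₇' := h₇') (h₈' := h₈') (h₉' := h₉')
    (fun x => (hκ x).elim fun _ ht => ht.1.trans ht.2.symm)
    (fun z => QuotientGroup.induction_on z hγ) (fun z => QuotientGroup.induction_on z hδ)
    (fun x => (hι x).elim fun _ ht => ht.1.trans ht.2.symm)
  exact ⟨h, fun t => hσ t⟩

/-- An equality of objects of a full subcategory may be checked in the ambient category, and so may
the identification of a morphism with the transport along it. -/
theorem exists_eq_eqToHom_of_obj {D : Type*} [Category D] {P : ObjectProperty D}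
    {X Y : P.FullSubcategory} (h : X.obj = Y.obj) (f : X ⟶ Y) (hf : f.hom = eqToHom h) :
    ∃ h : X = Y, f = eqToHom h := by
  obtain ⟨X, hX⟩ := X
  obtain ⟨Y, hY⟩ := Y
  obtain rfl : X = Y := h
  exact ⟨rfl, ObjectProperty.hom_ext _ hf⟩

/-! ### The comparison functor is an equivalence -/

section Comparison

variable {C B : Type u} [Group C] [CommGroup B]

/-- The abelian extension `(ι, δ)` underlying a self-equivalence of `I_ξ`. -/
def butterflyExtension (ξ : C →* MulAut B) (F : SelfEquiv ξ) : OpExt ξ where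
  E := Butterfly.F F.obj
  ext :=
    { inl := Butterfly.ι F.obj
      rightHom := Butterfly.δ F.obj
      inl_injective := Butterfly.ι_injective F.obj
      range_inl_eq_ker_rightHom := Butterfly.exact F.obj
      rightHom_surjective := Butterfly.δ_surjective F.obj }
  conj e b := by
    have h := Butterfly.ι_act F.obj e b
    rw [F.property.1] at h
    exact h

theorem Phi_isEquivalence (ξ : C →* MulAut B) : (Phi ξ).IsEquivalence where
  faithful := ⟨fun {X Y _ _} h => OpExt.Hom.ext' fun x =>
    congrArg (fun k : (Phi ξ).obj X ⟶ (Phi ξ).obj Y => Butterfly.Hom.σ k.hom x) h⟩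
  full := ⟨fun f =>
    ⟨⟨(Butterfly.Hom.σ f.hom).toMonoidHom, Butterfly.Hom.σ_ι f.hom, Butterfly.Hom.γ_σ f.hom⟩,
      ObjectProperty.hom_ext _ <| Butterfly.Hom.ext' fun _ => rfl⟩⟩
  essSurj := ⟨fun F => ⟨butterflyExtension ξ F,
    ⟨(isSelfEquivalence ξ).isoMk (Butterfly.toIso
      (Butterfly.homOfHom (F := extensionButterfly ξ (butterflyExtension ξ F)) (G := F.obj)
        (MonoidHom.id _) (fun _ => rfl)
        (fun b => (map_inv (Butterfly.ι F.obj) b).trans (F.property.2 b).symm)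
        (fun x => congrFun (congrArg DFunLike.coe F.property.1) x) (fun _ => rfl)))⟩⟩⟩

/-! ### The monoidal structure of the comparison functor -/

/-- The Baer sum and the composite of butterflies divide out the same subgroup of `E ×_C E'`. -/
theorem range_skew_extensionButterfly (ξ : C →* MulAut B) (X Y : OpExt ξ) :
    ((extensionButterfly ξ X).skew (extensionButterfly ξ Y)).range =
      (OpExt.codiag B).ker.map (X.fibKer Y) := by
  ext z
  constructor
  · rintro ⟨b, rfl⟩
    exact ⟨(b, b⁻¹), mul_inv_cancel (b : B), rfl⟩
  · rintro ⟨⟨a, b⟩, hab, rfl⟩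
    obtain rfl : b = a⁻¹ := (inv_eq_of_mul_eq_one_right hab).symm
    exact ⟨a, rfl⟩

/-- The comparison of `Φ(X) ⊗ Φ(Y)` with `Φ(X ⊕ Y)`, the identity on representatives. -/
noncomputable def phiTensorHom (ξ : C →* MulAut B) (X Y : OpExt ξ) :
    Butterfly.Hom ((extensionButterfly ξ X).comp (extensionButterfly ξ Y))
      (extensionButterfly ξ (X.baer Y)) :=
  Butterfly.homOfHom (F := (extensionButterfly ξ X).comp (extensionButterfly ξ Y))
    (G := extensionButterfly ξ (X.baer Y))
    (Butterfly.descHom (extensionButterfly ξ X) (extensionButterfly ξ Y)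
      (fun x y h => X.cls Y x y h) (fun _ _ _ _ _ _ _ => rfl)
      fun a _ => (X.cls_eq_one Y).2 ⟨a, rfl, (map_inv Y.κ a).symm⟩)
    (fun _ => rfl)
    (fun b => (X.cls_eq_cls Y).2 ⟨b,
      (congrArg (· * X.κ b) (map_inv X.κ b)).trans (inv_mul_cancel _),
      (one_mul _).trans (map_inv Y.κ b).symm⟩)
    (fun z => by
      obtain ⟨x, y, h, rfl⟩ := Butterfly.exists_cls _ _ z
      exact h)
    (fun z => by
      obtain ⟨x, y, h, rfl⟩ := Butterfly.exists_cls _ _ z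
      rfl)

theorem phiTensorHom_eq_eqToHom (ξ : C →* MulAut B) (X Y : OpExt ξ) :
    ∃ h : (extensionButterfly ξ X).comp (extensionButterfly ξ Y) =
      extensionButterfly ξ (X.baer Y), phiTensorHom ξ X Y = eqToHom h := by
  let P := (extensionButterfly ξ X).comp (extensionButterfly ξ Y)
  let Q := extensionButterfly ξ (X.baer Y)
  -- The subgroup is regarded as one of `X.fib Y`, which is the same fibre product by definition.
  let N : Subgroup (X.fib Y) :=
    ((extensionButterfly ξ X).skew (extensionButterfly ξ Y)).range
  have : N.Normal := Butterfly.skew_normal (extensionButterfly ξ X) (extensionButterfly ξ Y)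
  obtain ⟨h, hσ⟩ := Butterfly.exists_eqToHom_mk (E := unitCrossedExt ξ) (E' := unitCrossedExt ξ)
    (T := X.fib Y) (N := N)
    (N' := (OpExt.codiag B).ker.map (X.fibKer Y)) (range_skew_extensionButterfly ξ X Y)
    (κ := P.κ) (γ := P.γ) (δ := P.δ) (ι := P.ι)
    (h₁ := P.δ_κ) (h₂ := P.γ_ι) (h₃ := P.p_δ) (h₄ := P.γ_κ) (h₅ := P.ι_injective)
    (h₆ := P.exact) (h₇ := P.δ_surjective) (h₈ := P.κ_act) (h₉ := P.ι_act)
    (κ' := Q.κ) (γ' := Q.γ) (δ' := Q.δ) (ι' := Q.ι)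
    (h₁' := Q.δ_κ) (h₂' := Q.γ_ι) (h₃' := Q.p_δ) (h₄' := Q.γ_κ) (h₅' := Q.ι_injective)
    (h₆' := Q.exact) (h₇' := Q.δ_surjective) (h₈' := Q.κ_act) (h₉' := Q.ι_act)
    (fun b => ⟨⟨(X.κ b⁻¹, 1), (X.γ_κ _).trans (map_one Y.γ).symm⟩, rfl,
      ((phiTensorHom ξ X Y).σ_κ b).symm⟩)
    (fun t => t.2.symm) (fun _ => rfl)
    (fun b => ⟨⟨(1, Y.κ b), (map_one X.γ).trans (Y.γ_κ _).symm⟩, rfl, rfl⟩)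
  refine ⟨h, Butterfly.Hom.ext' fun z => ?_⟩
  obtain ⟨x, y, hxy, rfl⟩ := Butterfly.exists_cls _ _ z
  exact (hσ ⟨(x, y), hxy⟩).symm

/-- The comparison of the identity butterfly of `I_ξ` with `Φ(E_⋊)`, the identity of `B ⋊ C`. -/
noncomputable def phiUnitHom (ξ : C →* MulAut B) :
    Butterfly.Hom (Butterfly.idButterfly (unitCrossedExt ξ))
      (extensionButterfly ξ (OpExt.semidirect ξ)) :=
  Butterfly.homOfHom (F := Butterfly.idButterfly (unitCrossedExt ξ))
    (G := extensionButterfly ξ (OpExt.semidirect ξ)) (MonoidHom.id (B ⋊[ξ] C))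
    (fun _ => rfl) (fun _ => rfl) (fun _ => (one_mul _).symm) (fun _ => rfl)

theorem phiUnitHom_eq_eqToHom (ξ : C →* MulAut B) :
    ∃ h : Butterfly.idButterfly (unitCrossedExt ξ) = extensionButterfly ξ (OpExt.semidirect ξ),
      phiUnitHom ξ = eqToHom h := by
  let P := Butterfly.idButterfly (unitCrossedExt ξ)
  let Q := extensionButterfly ξ (OpExt.semidirect ξ)
  obtain ⟨h, hσ⟩ := Butterfly.exists_eqToHom (E := unitCrossedExt ξ) (E' := unitCrossedExt ξ)
    (T := B ⋊[ξ] C) (κ := P.κ) (γ := P.γ) (δ := P.δ) (ι := P.ι)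
    (h₁ := P.δ_κ) (h₂ := P.γ_ι) (h₃ := P.p_δ) (h₄ := P.γ_κ) (h₅ := P.ι_injective)
    (h₆ := P.exact) (h₇ := P.δ_surjective) (h₈ := P.κ_act) (h₉ := P.ι_act)
    (κ' := Q.κ) (γ' := Q.γ) (δ' := Q.δ) (ι' := Q.ι)
    (h₁' := Q.δ_κ) (h₂' := Q.γ_ι) (h₃' := Q.p_δ) (h₄' := Q.γ_κ) (h₅' := Q.ι_injective)
    (h₆' := Q.exact) (h₇' := Q.δ_surjective) (h₈' := Q.κ_act) (h₉' := Q.ι_act)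
    (fun _ => rfl) (fun _ => one_mul _) (fun _ => rfl) (fun _ => rfl)
  exact ⟨h, Butterfly.Hom.ext' fun z => (hσ z).symm⟩

/-- The comparison functor with its monoidal structure. -/
noncomputable def phiCoreMonoidal (ξ : C →* MulAut B) : (Phi ξ).CoreMonoidal where
  εIso := (isSelfEquivalence ξ).isoMk (Butterfly.toIso (phiUnitHom ξ))
  μIso X Y := (isSelfEquivalence ξ).isoMk (Butterfly.toIso (phiTensorHom ξ X Y))
  μIso_hom_natural_left f X' := ObjectProperty.hom_ext _ <| Butterfly.Hom.ext' fun z => by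
    obtain ⟨x, y, h, rfl⟩ := Butterfly.exists_cls _ _ z
    rfl
  μIso_hom_natural_right X' f := ObjectProperty.hom_ext _ <| Butterfly.Hom.ext' fun z => by
    obtain ⟨x, y, h, rfl⟩ := Butterfly.exists_cls _ _ z
    rfl
  associativity X Y Z := ObjectProperty.hom_ext _ <| Butterfly.Hom.ext' fun w => by
    obtain ⟨w, z, h, rfl⟩ := Butterfly.exists_cls _ _ w
    obtain ⟨x, y, h', rfl⟩ := Butterfly.exists_cls _ _ w
    have a : X.γ x = Y.γ y := h'
    have b : Y.γ y = Z.γ z := h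
    exact (OpExt.assoc_cls X Y Z a b).trans
      (congrArg (fun v => (phiTensorHom ξ X (Y.baer Z)).σ
        ((Butterfly.compMap (𝟙 (extensionButterfly ξ X)) (phiTensorHom ξ Y Z)).σ v))
        (Butterfly.assoc_cls (extensionButterfly ξ X) (extensionButterfly ξ Y)
          (extensionButterfly ξ Z) (h := h') h)).symm
  left_unitality X := ObjectProperty.hom_ext _ <| Butterfly.Hom.ext' fun z => by
    obtain ⟨x, y, h, rfl⟩ := Butterfly.exists_cls _ _ z
    -- The wing `κ` of `Φ(X)` is the inverse of that of `X`, and the left unitor of butterflies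
    -- inverts it again.
    have e : (X.κ (SemidirectProduct.left x)⁻¹)⁻¹ = X.κ (SemidirectProduct.left x) := by
      rw [map_inv, inv_inv]
    exact congrArg (fun v : X.E => v * (show X.E from y)) e
  right_unitality X := ObjectProperty.hom_ext _ <| Butterfly.Hom.ext' fun z => by
    obtain ⟨x, y, h, rfl⟩ := Butterfly.exists_cls _ _ z
    rfl

/-- The comparison functor is symmetric: both symmetries send the class of `(x, y)` to the class of
`(y, x)`. -/
noncomputable instance phiBraided (ξ : C →* MulAut B) : (Phi ξ).Braided where
  toMonoidal := (phiCoreMonoidal ξ).toMonoidal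
  braided X Y := ObjectProperty.hom_ext _ <| Butterfly.Hom.ext' fun z => by
    obtain ⟨x, y, h, rfl⟩ := Butterfly.exists_cls _ _ z
    rfl

/-- Every object of `Eq(I_ξ)` is isomorphic to some `Φ(X)`, whose inverse is the image under `Φ` of
the inverse of `X` for the Baer sum. -/
theorem selfEquiv_isTwoGroup (ξ : C →* MulAut B) : IsTwoGroup (SelfEquiv ξ) := by
  have := Phi_isEquivalence ξ
  refine ⟨⟨fun f => ((isSelfEquivalence ξ).isoMk (Butterfly.toIso f.hom)).isIso_hom⟩, fun F => ?_⟩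
  obtain ⟨Y, ⟨e⟩, _⟩ := (OpExt.isTwoGroup ξ).2 ((Phi ξ).objPreimage F)
  have i : F ⊗ (Phi ξ).obj Y ≅ 𝟙_ (SelfEquiv ξ) :=
    whiskerRightIso ((Phi ξ).objObjPreimageIso F).symm _ ≪≫ Functor.Monoidal.μIso (Phi ξ) _ _ ≪≫
      (Phi ξ).mapIso e ≪≫ (Functor.Monoidal.εIso (Phi ξ)).symm
  exact ⟨(Phi ξ).obj Y, ⟨i⟩, ⟨β_ _ _ ≪≫ i⟩⟩

end Comparison

theorem mainTheorem2 {C B : Type u} [Group C] [CommGroup B] (ξ : C →* MulAut B) :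
    IsTwoGroup (OpExt ξ) ∧ IsTwoGroup (SelfEquiv ξ) ∧ (Phi ξ).IsEquivalence ∧
      ∃ _ : (Phi ξ).Braided, IsStrictMonoidal (Phi ξ) := by
  refine ⟨OpExt.isTwoGroup ξ, selfEquiv_isTwoGroup ξ, Phi_isEquivalence ξ, phiBraided ξ, ?_, ?_⟩
  · obtain ⟨h, hh⟩ := phiUnitHom_eq_eqToHom ξ
    exact exists_eq_eqToHom_of_obj h _ hh
  · intro X Y
    obtain ⟨h, hh⟩ := phiTensorHom_eq_eqToHom ξ X Y
    exact exists_eq_eqToHom_of_obj h _ hh
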